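/- **Theorem.** Let $\mathbb{F}_q$ be a finite field with $q$ elements. For $1\le k\le n$ let $\mathcal{L}_k^*(\mathbb{F}_q^n)$ denote the set of $k$-dimensional linear subspaces of $\mathbb{F}_q^n$. For $S\subset\mathbb{F}_q^n$ and $\tau>0$, call $A\in\mathcal{L}_k^*(\mathbb{F}_q^n)$ *$\tau$-shift-balanced with respect to $S$* if for every $a\in\mathbb{F}_q^n$ the flat $A+a$ satisfies $$\left|\,|(A+a)\cap S|-\frac{|S|}{q^{n-k}}\,\right|\le \tau\cdot\frac{|S|}{q^{n-k}}.$$ Let $n\ge 5$ and let $S\subset\mathbb{F}_q^n$ be a set with $|S|>q^4$. Let $\tau>0$ and $\delta\in(0,1)$ be real numbers such that $$q\ \ge\ 32\max\left(\frac{n(1+\tau)}{(\tau\delta)^2},\,n\right).$$ Let $4\le r\le n-1$ be an integer such that $q^r<|S|\le q^{r+1}$ and let $k=n-r+3$. Then at least a $(1-\delta)$-fraction of all subspaces in $\mathcal{L}_k^*(\mathbb{F}_q^n)$ are $\tau$-shift-balanced with respect to $S$. -/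

import Mathlib

/-- The set `𝓛ₖ(F^n)` of `k`-dimensional flats (nonempty affine subspaces) of `F^n`. -/
def flats (F : Type*) [Field F] (n k : ℕ) : Set (AffineSubspace F (Fin n → F)) :=
  {R | (R : Set (Fin n → F)).Nonempty ∧ Module.finrank F R.direction = k}

/-- The set `𝓛ₖ*(F^n)` of `k`-dimensional linear subspaces of `F^n`. -/
def linearSubspaces (F : Type*) [Field F] (n k : ℕ) : Set (Submodule F (Fin n → F)) :=
  {A | Module.finrank F A = k}

/-- The translate `A + a` of a `k`-dimensional subspace `A`, as a `k`-dimensional flat. -/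
def shift {F : Type*} [Field F] {n k : ℕ} (A : linearSubspaces F n k) (a : Fin n → F) :
    flats F n k :=
  ⟨AffineSubspace.mk' a A.1, ⟨a, AffineSubspace.self_mem_mk' a A.1⟩, by
    rw [AffineSubspace.direction_mk']; exact A.2⟩

/-- `Eₖ(S) = |S| / q^(n-k)` with `q = |F|`, where `k ≤ n`. -/
noncomputable def expectedCard {F : Type*} [Field F] {n : ℕ} (k : ℕ) (S : Set (Fin n → F)) : ℝ :=
  (S.ncard : ℝ) / (Nat.card F : ℝ) ^ (n - k)

/-- The `k`-flat `R` is `τ`-balanced with respect to `S`. -/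
def IsBalanced {F : Type*} [Field F] {n k : ℕ} (τ : ℝ) (S : Set (Fin n → F))
    (R : flats F n k) : Prop :=
  |((((R.1 : Set (Fin n → F)) ∩ S).ncard : ℕ) : ℝ) - expectedCard k S| ≤ τ * expectedCard k S

/-- The `k`-dimensional subspace `A` is `τ`-shift-balanced with respect to `S`: all of its
translates are `τ`-balanced with respect to `S`. -/
def IsShiftBalanced {F : Type*} [Field F] {n k : ℕ} (τ : ℝ) (S : Set (Fin n → F))
    (A : linearSubspaces F n k) : Prop :=
  ∀ a : Fin n → F, IsBalanced τ S (shift A a)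

/-! Put m = r - 1, so that k + m = n + 2, and μ = |S| / q^m, which exceeds q. Take a random linear
map φ from F^n to F^m. Its values at distinct points of S are pairwise independent enough for
Chebyshev: on average at most a proportion ε = 4(1+τ)/(τ²μ) of the points y of F^m have a fibre in S
whose size deviates from μ by at least τμ/2. Call the set of these points T(φ).

Let P be a plane in F^m. For most φ the preimage φ⁻¹(P) has dimension k, and by symmetry it is then
uniformly distributed over the k-dimensional subspaces. If it is a subspace A with an unbalanced
translate a + A, the same second moment argument inside a + A shows that typically nearly all of the
plane φ(a) + P lies in T(φ): φ "catches" P.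

Suppose that the bad subspaces have density above δ. Each plane is then caught with probability at
least about δ/2, so about 4/δ well-chosen maps (`exists_covering_choice`) catch more than half of
all pairs (u, v), while the union T' of their sets T(φ) has density at most 1/2. This contradicts a
Kakeya-type bound for planes (`card_lt_two_mul_card_of_planes`): a set nearly containing a translate
of the plane spanned by u, v, for half of all pairs, has more than q^m / 2 points.

That bound is proved by the method of multiplicities. A polynomial Q of low degree vanishing to high
order on T' vanishes to order l along each of these planes, so its top-degree form vanishes to order
l at u + ωv, a point over F[ω]. The points u + ωv fill a large part of a grid with side q², which is
too much for Schwartz-Zippel with multiplicities. -/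

open MvPolynomial in
/-- `Q` vanishes to order at least `M` at the point `a`. -/
def VanishesToOrder {σ R : Type*} [CommRing R] (Q : MvPolynomial σ R) (a : σ → R) (M : ℕ) : Prop :=
  aeval (fun i => C (a i) + X i) Q ∈ idealOfVars σ R ^ M

/-! ### Powers of the ideal of the variables -/

namespace MvPolynomial

section Ideals

variable {σ R : Type*} [CommRing R]

theorem X_mem_idealOfVars (i : σ) : (X i : MvPolynomial σ R) ∈ idealOfVars σ R := by
  have := (mem_pow_idealOfVars_iff' (σ := σ) (R := R) 1 (X i)).2 (fun x hx => by
    classical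
    rw [coeff_X, if_neg]
    rintro rfl
    simp at hx)
  simpa using this

theorem aeval_mem_pow_of_forall_mem {A : Type*} [CommRing A] [Algebra R A] {J : Ideal A}
    {g : σ → A} (hg : ∀ i, g i ∈ J) {p : MvPolynomial σ R} {M : ℕ}
    (hp : p ∈ idealOfVars σ R ^ M) : aeval g p ∈ J ^ M := by
  have h1 : (idealOfVars σ R).map (aeval g : MvPolynomial σ R →ₐ[R] A) ≤ J := by
    rw [idealOfVars, Ideal.map_span, Ideal.span_le]
    rintro _ ⟨_, ⟨i, rfl⟩, rfl⟩
    simpa using hg i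
  have h2 := Ideal.mem_map_of_mem (aeval g : MvPolynomial σ R →ₐ[R] A) hp
  rw [Ideal.map_pow] at h2
  exact Ideal.pow_right_mono h1 M h2

/-- The polynomials whose coefficient at `i` lies in `I ^ (M - |i|)`. -/
def coeffFiltration (σ : Type*) (I : Ideal R) (M : ℕ) : Ideal (MvPolynomial σ R) where
  carrier := {p | ∀ i, coeff i p ∈ I ^ (M - i.degree)}
  add_mem' hp hq i := by rw [coeff_add]; exact add_mem (hp i) (hq i)
  zero_mem' i := by simp
  smul_mem' c p hp i := by
    classical
    rw [smul_eq_mul, coeff_mul]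
    refine sum_mem fun x hx => Ideal.mul_mem_left _ _ (Ideal.pow_le_pow_right ?_ (hp x.2))
    rw [← Finset.HasAntidiagonal.mem_antidiagonal.1 hx, map_add]
    omega

theorem mul_mem_coeffFiltration {I : Ideal R} {M : ℕ} {g p : MvPolynomial σ R}
    (hg : g ∈ I.map C ⊔ idealOfVars σ R) (hp : p ∈ coeffFiltration σ I M) :
    g * p ∈ coeffFiltration σ I (M + 1) := by
  classical
  have key : I.map C ⊔ idealOfVars σ R ≤
      (coeffFiltration σ I (M + 1)).colon ({p} : Set (MvPolynomial σ R)) := by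
    refine sup_le ?_ ?_
    · rw [Ideal.map, Ideal.span_le]
      rintro _ ⟨a, ha, rfl⟩
      refine Submodule.mem_colon_singleton.2 fun i => ?_
      rw [smul_eq_mul, coeff_C_mul]
      by_cases h : i.degree ≤ M
      · rw [Nat.sub_add_comm h, pow_succ']
        exact Ideal.mul_mem_mul ha (hp i)
      · rw [Nat.sub_eq_zero_of_le (by omega)]
        simp
    · rw [idealOfVars, Ideal.span_le]
      rintro _ ⟨s, rfl⟩
      refine Submodule.mem_colon_singleton.2 fun i => ?_
      rw [smul_eq_mul, coeff_X_mul']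
      split_ifs with h
      · have h2 := hp (i - Finsupp.single s 1)
        have h3 : i - Finsupp.single s 1 + Finsupp.single s 1 = i := by
          ext j
          rcases eq_or_ne j s with rfl | hj
          · have := Finsupp.mem_support_iff.1 h
            simp; omega
          · simp [hj.symm]
        have h4 : (i - Finsupp.single s 1).degree + 1 = i.degree := by
          conv_rhs => rw [← h3]
          simp
        convert h2 using 2
        omega
      · exact zero_mem _
  simpa using Submodule.mem_colon_singleton.1 (key hg)

/-- In a product of M factors from (I, Z), reaching the monomial Z^i uses at most |i| factors from
the variables, and the others come from I. This is how derivatives lower the order of vanishing. For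
|i| ≥ M the truncated exponent is 0 and nothing is claimed. -/
theorem coeff_mem_pow_of_mem_sup_pow {I : Ideal R} {M : ℕ} {p : MvPolynomial σ R}
    (hp : p ∈ (I.map C ⊔ idealOfVars σ R) ^ M) (i : σ →₀ ℕ) :
    coeff i p ∈ I ^ (M - i.degree) := by
  have key : (I.map C ⊔ idealOfVars σ R) ^ M ≤ coeffFiltration σ I M := by
    clear hp
    induction M with
    | zero => intro p _ i; simp
    | succ M ih =>
      rw [pow_succ']
      exact Ideal.mul_le.2 fun g hg p hp => mul_mem_coeffFiltration hg (ih hp)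
  exact key hp i

end Ideals

end MvPolynomial

/-! ### Schwartz-Zippel with multiplicities -/

theorem Polynomial.sum_le_natDegree_of_pow_dvd {K : Type*} [CommRing K] [IsDomain K]
    {q : Polynomial K} (hq : q ≠ 0) (S : Finset K) (e : K → ℕ)
    (h : ∀ y ∈ S, (Polynomial.X - Polynomial.C y) ^ e y ∣ q) :
    ∑ y ∈ S, e y ≤ q.natDegree := by
  classical
  calc ∑ y ∈ S, e y ≤ ∑ y ∈ S, q.roots.count y := by
        refine Finset.sum_le_sum fun y hy => ?_
        rw [Polynomial.count_roots]
        exact (Polynomial.le_rootMultiplicity_iff hq).2 (h y hy)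
    _ ≤ q.roots.card := by
        calc ∑ y ∈ S, q.roots.count y ≤ ∑ y ∈ S ∪ q.roots.toFinset, q.roots.count y :=
              Finset.sum_le_sum_of_subset Finset.subset_union_left
          _ = q.roots.card :=
              Multiset.sum_count_eq_card fun a ha =>
                Finset.mem_union_right _ (Multiset.mem_toFinset.2 ha)
    _ ≤ q.natDegree := q.card_roots'

namespace MvPolynomial

section Shift

variable {σ R : Type*} [CommRing R]

theorem aeval_C_add_X_injective (a : σ → R) :
    Function.Injective (aeval (fun i => C (a i) + X i) : MvPolynomial σ R →ₐ[R] MvPolynomial σ R) := by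
  have h : ((aeval (fun i => X i - C (a i)) : MvPolynomial σ R →ₐ[R] MvPolynomial σ R).comp
      (aeval (fun i => C (a i) + X i))) = AlgHom.id R _ := by
    ext i
    simp [← algebraMap_eq]
  intro p q hpq
  have := congrArg (aeval (fun i => X i - C (a i)) : MvPolynomial σ R →ₐ[R] MvPolynomial σ R) hpq
  rwa [← AlgHom.comp_apply, ← AlgHom.comp_apply, h] at this

/-- An exponent of least degree in the expansion of `p` at `a` works; its degree is the exact
multiplicity there. -/
theorem exists_coeff_shift_ne_zero {p : MvPolynomial σ R} (hp : p ≠ 0) (a : σ → R) :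
    ∃ i : σ →₀ ℕ, coeff i (aeval (fun i => C (a i) + X i) p : MvPolynomial σ R) ≠ 0 ∧
      VanishesToOrder p a i.degree := by
  have h0 : (aeval (fun i => C (a i) + X i) p : MvPolynomial σ R) ≠ 0 := by
    rw [Ne, map_eq_zero_iff _ (aeval_C_add_X_injective a)]
    exact hp
  obtain ⟨i, hi, hmin⟩ := Finset.exists_min_image _ Finsupp.degree (support_nonempty.2 h0)
  exact ⟨i, mem_support_iff.1 hi, (mem_pow_idealOfVars_iff _ _).2 hmin⟩

/-- Substitute `Y` for the first variable and `x + Z` for the others. -/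
noncomputable def shiftTail {n : ℕ} (x : Fin n → R) :
    MvPolynomial (Fin (n + 1)) R →ₐ[R] MvPolynomial (Fin n) (Polynomial R) :=
  aeval (Fin.cons (C Polynomial.X) fun j => C (Polynomial.C (x j)) + X j)

theorem shiftTail_apply {n : ℕ} (x : Fin n → R) (Q : MvPolynomial (Fin (n + 1)) R) :
    shiftTail x Q = (finSuccEquiv R n Q).eval₂
      ((map Polynomial.C).comp
        (aeval (fun i => C (x i) + X i) : MvPolynomial (Fin n) R →ₐ[R] _).toRingHom)
      (C Polynomial.X) := by
  induction Q using MvPolynomial.induction_on with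
  | C a =>
    simp [shiftTail, finSuccEquiv_apply, MvPolynomial.algebraMap_eq,
      MvPolynomial.algebraMap_apply, Polynomial.algebraMap_eq]
  | add p q hp hq => rw [map_add, map_add, Polynomial.eval₂_add, hp, hq]
  | mul_X p i hp =>
    rw [map_mul, map_mul, Polynomial.eval₂_mul, hp]
    congr 1
    refine Fin.cases ?_ (fun j => ?_) i
    · simp [shiftTail, finSuccEquiv_X_zero]
    · simp [shiftTail, finSuccEquiv_X_succ]

theorem coeff_coeff_shiftTail {n : ℕ} (x : Fin n → R) (Q : MvPolynomial (Fin (n + 1)) R)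
    (i : Fin n →₀ ℕ) (j : ℕ) :
    (coeff i (shiftTail x Q)).coeff j =
      coeff i (aeval (fun i => C (x i) + X i) ((finSuccEquiv R n Q).coeff j) : MvPolynomial _ R) := by
  rw [shiftTail_apply, Polynomial.eval₂_eq_sum_range, coeff_sum, Polynomial.finsetSum_coeff]
  simp only [← C_pow, mul_comm _ (C _), coeff_C_mul, RingHom.comp_apply, coeff_map,
    Polynomial.coeff_mul_C, Polynomial.coeff_X_pow, ite_mul, one_mul, zero_mul]
  rw [Finset.sum_ite_eq]
  split_ifs with h
  · rfl
  · rw [Polynomial.coeff_eq_zero_of_natDegree_lt (by simpa using h)]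
    simp

/-- Near (y, x) the first variable Y is y + (Y - y), so the hypothesis puts Q(Y, x + Z) in the
`w`-th power of the ideal (Y - y, Z). Its coefficient at Z^i then has a zero of order at least w -
|i| at y. -/
theorem pow_dvd_coeff_shiftTail {n : ℕ} {x : Fin n → R} {y : R}
    {Q : MvPolynomial (Fin (n + 1)) R} {w : ℕ} (h : VanishesToOrder Q (Fin.cons y x) w)
    (i : Fin n →₀ ℕ) :
    (Polynomial.X - Polynomial.C y) ^ (w - i.degree) ∣ coeff i (shiftTail x Q) := by
  set I : Ideal (Polynomial R) := Ideal.span {Polynomial.X - Polynomial.C y}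
  let g : Fin (n + 1) → MvPolynomial (Fin n) (Polynomial R) :=
    Fin.cons (C (Polynomial.X - Polynomial.C y)) fun j => X j
  have hg : ∀ k, g k ∈ I.map C ⊔ idealOfVars (Fin n) (Polynomial R) := by
    refine Fin.cases ?_ fun j => ?_
    · exact Ideal.mem_sup_left (Ideal.mem_map_of_mem _ (Ideal.mem_span_singleton_self _))
    · exact Ideal.mem_sup_right (X_mem_idealOfVars j)
  have h1 := aeval_mem_pow_of_forall_mem hg h
  have h2 : aeval g (aeval (fun i => C ((Fin.cons y x : Fin (n + 1) → R) i) + X i) Q :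
      MvPolynomial (Fin (n + 1)) R) = shiftTail x Q := by
    rw [← AlgHom.comp_apply]
    congr 1
    ext k : 1
    refine Fin.cases ?_ (fun j => ?_) k
    · simp [shiftTail, g, MvPolynomial.algebraMap_apply, Polynomial.algebraMap_eq]
    · simp [shiftTail, g, MvPolynomial.algebraMap_apply, Polynomial.algebraMap_eq]
  rw [h2] at h1
  have h3 := coeff_mem_pow_of_mem_sup_pow h1 i
  rwa [Ideal.span_singleton_pow, Ideal.mem_span_singleton] at h3

end Shift

/-- The Schwartz-Zippel lemma with multiplicities. -/
theorem card_mul_sum_le_of_vanishesToOrder {K : Type*} [CommRing K] [IsDomain K] (S : Finset K)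
    {n : ℕ} {Q : MvPolynomial (Fin n) K} (hQ : Q ≠ 0) (w : (Fin n → K) → ℕ)
    (hw : ∀ a, VanishesToOrder Q a (w a)) :
    S.card * ∑ a ∈ Fintype.piFinset (fun _ => S), w a ≤ Q.totalDegree * S.card ^ n := by
  classical
  induction n with
  | zero =>
    have h0 : ∀ a, w a = 0 := by
      intro a
      have h := hw a
      rw [eq_C_of_isEmpty Q] at h
      unfold VanishesToOrder at h
      rw [aeval_C, algebraMap_eq, C_mem_pow_idealOfVars_iff] at h
      rcases h with h | h
      · exact absurd (by rw [eq_C_of_isEmpty Q, h, C_0]) hQ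
      · exact h
    simp [h0]
  | succ n ih =>
    set P := finSuccEquiv K n Q with hP
    have hP0 : P ≠ 0 := by simpa [hP] using hQ
    set t := P.natDegree with ht
    have hPt : P.coeff t ≠ 0 := by simpa [ht] using hP0
    choose i hi hvan using fun x : Fin n → K => exists_coeff_shift_ne_zero hPt x
    have hih := ih hPt (fun x => (i x).degree) hvan
    have hdeg : (P.coeff t).totalDegree + t ≤ Q.totalDegree :=
      totalDegree_coeff_finSuccEquiv_add_le Q t hPt
    -- On the line over x, take the coefficient of Z^i in Q(Y, x + Z), where |i| is the multiplicity
    -- at x of the leading coefficient in Y. It is nonzero of degree t and has zeros of order at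
    -- least w - |i|.
    have hline : ∀ x : Fin n → K,
        ∑ y ∈ S, w (Fin.cons y x) ≤ S.card * (i x).degree + t := by
      intro x
      set p := coeff (i x) (shiftTail x Q)
      have hpt : p.coeff t ≠ 0 := by
        rw [coeff_coeff_shiftTail]; exact hi x
      have hpd : p.natDegree ≤ t := by
        refine Polynomial.natDegree_le_iff_coeff_eq_zero.2 fun N hN => ?_
        rw [coeff_coeff_shiftTail, Polynomial.coeff_eq_zero_of_natDegree_lt hN]
        simp
      have h1 := Polynomial.sum_le_natDegree_of_pow_dvd (q := p) (by rintro h; simp [h] at hpt) S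
        (fun y => w (Fin.cons y x) - (i x).degree)
        (fun y _ => pow_dvd_coeff_shiftTail (hw _) (i x))
      calc ∑ y ∈ S, w (Fin.cons y x)
          ≤ ∑ y ∈ S, ((i x).degree + (w (Fin.cons y x) - (i x).degree)) :=
            Finset.sum_le_sum fun y _ => by omega
        _ ≤ S.card * (i x).degree + t := by
            rw [Finset.sum_add_distrib, Finset.sum_const, smul_eq_mul]
            omega
    have hsum : ∑ a ∈ Fintype.piFinset (fun _ : Fin (n + 1) => S), w a =
        ∑ x ∈ Fintype.piFinset (fun _ : Fin n => S), ∑ y ∈ S, w (Fin.cons y x) := by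
      rw [← Finset.sum_product']
      refine Finset.sum_bij' (fun a _ => (Fin.tail a, a 0)) (fun b _ => Fin.cons b.2 b.1) ?_ ?_ ?_ ?_ ?_
      · intro a ha
        rw [Fintype.mem_piFinset] at ha
        simp [Fintype.mem_piFinset, Fin.tail, ha]
      · rintro ⟨x, y⟩ hb
        simp only [Finset.mem_product, Fintype.mem_piFinset] at hb ⊢
        exact Fin.cases hb.2 hb.1
      · intro a _; simp
      · intro a _; simp
      · intro a _; simp
    rw [hsum]
    calc S.card * ∑ x ∈ Fintype.piFinset (fun _ : Fin n => S), ∑ y ∈ S, w (Fin.cons y x)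
        ≤ S.card * ∑ x ∈ Fintype.piFinset (fun _ : Fin n => S), (S.card * (i x).degree + t) :=
          Nat.mul_le_mul_left _ (Finset.sum_le_sum fun x _ => hline x)
      _ = S.card * (S.card * ∑ x ∈ Fintype.piFinset (fun _ : Fin n => S), (i x).degree)
            + t * S.card ^ (n + 1) := by
          rw [Finset.sum_add_distrib, ← Finset.mul_sum, Finset.sum_const, Fintype.card_piFinset]
          simp; ring
      _ ≤ S.card * ((P.coeff t).totalDegree * S.card ^ n) + t * S.card ^ (n + 1) := by
          gcongr
      _ = ((P.coeff t).totalDegree + t) * S.card ^ (n + 1) := by ring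
      _ ≤ Q.totalDegree * S.card ^ (n + 1) := Nat.mul_le_mul_right _ hdeg

end MvPolynomial

/-! ### Interpolation by dimension count -/

namespace MvPolynomial

section Interpolation

/-- The exponents in `m` variables of degree at most `d`. -/
noncomputable def exponentsLE (m d : ℕ) : Finset (Fin m →₀ ℕ) :=
  (Finset.range (d + 1)).biUnion fun e => Finset.univ.finsuppAntidiag e

theorem mem_exponentsLE {m d : ℕ} {i : Fin m →₀ ℕ} : i ∈ exponentsLE m d ↔ i.degree ≤ d := by
  simp [exponentsLE, Finset.mem_finsuppAntidiag, Finsupp.degree_eq_sum]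

theorem card_exponentsLE (m d : ℕ) : (exponentsLE m d).card = (d + m).choose m := by
  have h1 : (exponentsLE m d).card = ∑ e ∈ Finset.range (d + 1), m.multichoose e := by
    rw [exponentsLE, Finset.card_biUnion]
    · simp [Finset.card_finsuppAntidiag_nat_eq_multichoose]
    · intro a _ b _ hab
      rw [Function.onFun, Finset.disjoint_left]
      intro i hi hj
      exact hab ((Finset.mem_finsuppAntidiag.1 hi).1.symm.trans (Finset.mem_finsuppAntidiag.1 hj).1)
  have h2 : ∀ d, ∑ e ∈ Finset.range (d + 1), m.multichoose e = (m + 1).multichoose d := by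
    intro d
    induction d with
    | zero => simp
    | succ d ih => rw [Finset.sum_range_succ, ih, Nat.multichoose_succ_succ, add_comm]
  rw [h1, h2, Nat.multichoose_eq, Nat.choose_symm_of_eq_add (by omega : m + 1 + d - 1 = d + m)]
  congr 1
  omega

theorem pow_le_factorial_mul_card_exponentsLE (m d : ℕ) :
    d ^ m ≤ m.factorial * (exponentsLE m d).card := by
  rw [card_exponentsLE, ← Nat.ascFactorial_eq_factorial_mul_choose]
  exact (Nat.pow_le_pow_left (Nat.le_succ d) m).trans (Nat.pow_succ_le_ascFactorial _ _)

theorem factorial_mul_card_exponentsLE_le (m d : ℕ) :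
    m.factorial * (exponentsLE m d).card ≤ (d + m) ^ m := by
  rw [card_exponentsLE, ← Nat.ascFactorial_eq_factorial_mul_choose]
  exact Nat.ascFactorial_le_pow_add d m

/-- The vanishing conditions are fewer than the available coefficients, as a comparison of both
counts times m! shows. The proof imposes the conditions of degree exactly M as well, which is
harmless. -/
theorem exists_vanishesToOrder {F : Type*} [Field F] {m : ℕ} (T : Finset (Fin m → F)) (d M : ℕ)
    (h : T.card * (M + m) ^ m < d ^ m) :
    ∃ Q : MvPolynomial (Fin m) F, Q ≠ 0 ∧ Q.totalDegree ≤ d ∧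
      ∀ a ∈ T, VanishesToOrder Q a M := by
  classical
  let build : (exponentsLE m d → F) →ₗ[F] MvPolynomial (Fin m) F :=
    Fintype.linearCombination F fun i => monomial i.1 (1 : F)
  have hbuild : ∀ c, build c = ∑ i, monomial i.1 (c i) := by
    intro c
    simp [build, Fintype.linearCombination_apply, smul_monomial]
  have hcoeff : ∀ c (i : exponentsLE m d), coeff i.1 (build c) = c i := by
    intro c i
    rw [hbuild, coeff_sum]
    simp only [coeff_monomial]
    rw [Finset.sum_eq_single i]
    · simp
    · intro b _ hb
      rw [if_neg]
      exact fun h => hb (Subtype.ext h)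
    · simp
  let ev : (exponentsLE m d → F) →ₗ[F] (T × exponentsLE m M → F) :=
    LinearMap.pi fun p => (lcoeff F p.2.1).comp
      ((aeval (fun i => C (p.1.1 i) + X i) : MvPolynomial (Fin m) F →ₐ[F] _).toLinearMap.comp build)
  have hlt : Module.finrank F (T × exponentsLE m M → F) < Module.finrank F (exponentsLE m d → F) := by
    rw [Module.finrank_fintype_fun_eq_card, Module.finrank_fintype_fun_eq_card, Fintype.card_prod,
      Fintype.card_coe, Fintype.card_coe, Fintype.card_coe]
    have h1 := factorial_mul_card_exponentsLE_le m M
    have h2 := pow_le_factorial_mul_card_exponentsLE m d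
    have h3 : m.factorial * (T.card * (exponentsLE m M).card) <
        m.factorial * (exponentsLE m d).card := by
      calc m.factorial * (T.card * (exponentsLE m M).card)
          = T.card * (m.factorial * (exponentsLE m M).card) := by ring
        _ ≤ T.card * (M + m) ^ m := Nat.mul_le_mul_left _ h1
        _ < _ := h.trans_le h2
    exact lt_of_mul_lt_mul_left h3 (Nat.zero_le _)
  obtain ⟨c, hc, hc0⟩ := Submodule.exists_mem_ne_zero_of_ne_bot (ev.ker_ne_bot_of_finrank_lt hlt)
  refine ⟨build c, ?_, ?_, ?_⟩
  · intro h0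
    apply hc0
    ext i
    rw [← hcoeff c i, h0]
    simp
  · rw [hbuild]
    refine totalDegree_finsetSum_le fun i _ => ?_
    refine (totalDegree_monomial_le _ _).trans ?_
    exact mem_exponentsLE.1 i.2
  · intro a ha
    refine (mem_pow_idealOfVars_iff' _ _).2 fun i hi => ?_
    have := congrFun (LinearMap.mem_ker.1 hc) (⟨a, ha⟩, ⟨i, mem_exponentsLE.2 hi.le⟩)
    exact this

end Interpolation

/-! ### Top-degree parts and degrees of coefficients -/

section TopDegree

variable {σ R : Type*} [CommRing R] {B : Type*} [CommRing B] [Algebra R B]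

/-- The coefficient of `λ ^ e` in `Q (x + λ g)` is the degree `e` part of `Q` evaluated at `g`. -/
theorem coeff_aeval_C_add_C_mul_X {Q : MvPolynomial σ R} {e : ℕ} (hQ : Q.totalDegree ≤ e)
    (x g : σ → B) :
    (aeval (fun k => Polynomial.C (x k) + Polynomial.C (g k) * Polynomial.X) Q :
      Polynomial B).coeff e = aeval g (homogeneousComponent e Q) := by
  classical
  have hlin : ∀ k, (Polynomial.C (x k) + Polynomial.C (g k) * Polynomial.X).natDegree ≤ 1 := by
    intro k
    compute_degree
  have hpow : ∀ (i : σ →₀ ℕ) (s : Finset σ),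
      (∏ k ∈ s, (Polynomial.C (x k) + Polynomial.C (g k) * Polynomial.X) ^ i k).natDegree
        ≤ ∑ k ∈ s, i k ∧
      (∏ k ∈ s, (Polynomial.C (x k) + Polynomial.C (g k) * Polynomial.X) ^ i k).coeff (∑ k ∈ s, i k)
        = ∏ k ∈ s, g k ^ i k := by
    intro i s
    have h1 : ∀ k, ((Polynomial.C (x k) + Polynomial.C (g k) * Polynomial.X) ^ i k).natDegree
        ≤ i k := fun k => by simpa using Polynomial.natDegree_pow_le_of_le (i k) (hlin k)
    induction s using Finset.induction_on with
    | empty => simp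
    | insert a s ha ih =>
      rw [Finset.prod_insert ha, Finset.sum_insert ha, Finset.prod_insert ha]
      refine ⟨Polynomial.natDegree_mul_le_of_le (h1 a) ih.1, ?_⟩
      rw [Polynomial.coeff_mul_add_eq_of_natDegree_le (h1 a) ih.1, ih.2]
      congr 1
      have := Polynomial.coeff_pow_of_natDegree_le (m := i a) (hlin a)
      rw [mul_one] at this
      rw [this]
      simp
  rw [aeval_def, eval₂_eq, Polynomial.finsetSum_coeff, homogeneousComponent_apply, map_sum,
    Finset.sum_filter]
  refine Finset.sum_congr rfl fun i hi => ?_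
  rw [Polynomial.algebraMap_apply, Polynomial.coeff_C_mul]
  have hdeg : i.degree = ∑ k ∈ i.support, i k := rfl
  split_ifs with h
  · rw [← h, hdeg, (hpow i i.support).2, aeval_monomial]
    rfl
  · have hle : i.degree ≤ e := (le_totalDegree hi).trans hQ
    rw [Polynomial.coeff_eq_zero_of_natDegree_lt, mul_zero]
    exact (hpow i i.support).1.trans_lt (by rw [← hdeg]; omega)

end TopDegree

section CoeffDegree

variable {σ τ R : Type*} [CommRing R]

theorem totalDegree_coeff_mul_le {G H : MvPolynomial σ (MvPolynomial τ R)} {a b : ℕ}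
    (hG : ∀ i, (coeff i G).totalDegree ≤ a) (hH : ∀ i, (coeff i H).totalDegree ≤ b)
    (i : σ →₀ ℕ) : (coeff i (G * H)).totalDegree ≤ a + b := by
  classical
  rw [coeff_mul]
  exact totalDegree_finsetSum_le fun x _ =>
    (totalDegree_mul _ _).trans (Nat.add_le_add (hG _) (hH _))

theorem totalDegree_coeff_aeval_le {σ' : Type*} {Q : MvPolynomial σ' R}
    {g : σ' → MvPolynomial σ (MvPolynomial τ R)} (hg : ∀ k i, (coeff i (g k)).totalDegree ≤ 1)
    (i : σ →₀ ℕ) : (coeff i (aeval g Q)).totalDegree ≤ Q.totalDegree := by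
  classical
  have hC : ∀ (c : MvPolynomial τ R) i, (coeff i (C c : MvPolynomial σ _)).totalDegree
      ≤ c.totalDegree := by
    intro c i
    rw [coeff_C]
    split_ifs <;> simp
  have hpow : ∀ k (e : ℕ) i, (coeff i (g k ^ e)).totalDegree ≤ e := by
    intro k e
    induction e with
    | zero =>
      intro i
      simpa using hC 1 i
    | succ e ih => rw [pow_succ]; exact totalDegree_coeff_mul_le ih (hg k)
  have hprod : ∀ (j : σ' →₀ ℕ) (s : Finset σ') i,
      (coeff i (∏ k ∈ s, g k ^ j k)).totalDegree ≤ ∑ k ∈ s, j k := by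
    intro j s
    induction s using Finset.induction_on with
    | empty => intro i; simpa using hC 1 i
    | insert a s ha ih =>
      rw [Finset.prod_insert ha, Finset.sum_insert ha]
      exact totalDegree_coeff_mul_le (hpow a _) ih
  rw [aeval_def, eval₂_eq, coeff_sum]
  refine totalDegree_finsetSum_le fun j hj => ?_
  have h1 : ∀ i, (coeff i (algebraMap R (MvPolynomial σ (MvPolynomial τ R)) (coeff j Q))).totalDegree
      ≤ 0 := by
    intro i
    rw [algebraMap_apply, algebraMap_eq]
    exact (hC _ i).trans (by simp)
  refine (totalDegree_coeff_mul_le h1 (hprod j j.support) i).trans ?_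
  rw [zero_add]
  exact le_totalDegree hj

end CoeffDegree

end MvPolynomial

/-! ### Restriction to planes and the Kakeya-type bound -/

namespace MvPolynomial

section Plane

variable {σ F : Type*} [Field F]

/-- The restriction `Q (x + s u + t v + Z)` of `Q` to a neighbourhood of a plane, as a polynomial
in `Z` with coefficients in `F[s, t]`. -/
noncomputable def planeExpansion (x u v : σ → F) :
    MvPolynomial σ F →ₐ[F] MvPolynomial σ (MvPolynomial (Fin 2) F) :=
  aeval fun k => C (C (x k) + C (u k) * X 0 + C (v k) * X 1) + X k

theorem totalDegree_coeff_planeExpansion_le (x u v : σ → F) (Q : MvPolynomial σ F) (i : σ →₀ ℕ) :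
    (coeff i (planeExpansion x u v Q)).totalDegree ≤ Q.totalDegree := by
  classical
  refine totalDegree_coeff_aeval_le (fun k i => ?_) i
  have hC : ∀ (c : F) (j : Fin 2), (C c * X j : MvPolynomial (Fin 2) F).totalDegree ≤ 1 := by
    intro c j
    refine (totalDegree_mul _ _).trans ?_
    simp
  rw [coeff_add, coeff_C, coeff_X]
  refine (totalDegree_add _ _).trans (max_le ?_ ?_)
  · split_ifs
    · refine (totalDegree_add _ _).trans (max_le ((totalDegree_add _ _).trans (max_le ?_ (hC _ _)))
        (hC _ _))
      simp
    · simp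
  · split_ifs <;> simp

theorem vanishesToOrder_coeff_planeExpansion {x u v : σ → F} {Q : MvPolynomial σ F} {st : Fin 2 → F}
    {M : ℕ} (h : VanishesToOrder Q (x + st 0 • u + st 1 • v) M) (i : σ →₀ ℕ) :
    VanishesToOrder (coeff i (planeExpansion x u v Q)) st (M - i.degree) := by
  let θ : σ → MvPolynomial σ (MvPolynomial (Fin 2) F) :=
    fun k => C (C (u k) * X 0 + C (v k) * X 1) + X k
  have hθ : ∀ k, θ k ∈ (idealOfVars (Fin 2) F).map C ⊔ idealOfVars σ (MvPolynomial (Fin 2) F) :=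
    fun k => add_mem (Ideal.mem_sup_left (Ideal.mem_map_of_mem _ (add_mem
      (Ideal.mul_mem_left _ _ (X_mem_idealOfVars 0)) (Ideal.mul_mem_left _ _ (X_mem_idealOfVars 1)))))
      (Ideal.mem_sup_right (X_mem_idealOfVars k))
  have h1 := coeff_mem_pow_of_mem_sup_pow (aeval_mem_pow_of_forall_mem hθ h) i
  let sh : MvPolynomial (Fin 2) F →ₐ[F] MvPolynomial (Fin 2) F := aeval fun i => C (st i) + X i
  -- Moving the origin of the (s, t)-plane to `st` turns the plane expansion into the expansion of Q
  -- at x + st₀u + st₁v, with su + tv + Z as the local variable.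
  have h2 : (mapAlgHom sh).comp (planeExpansion x u v) =
      ((aeval θ).comp (aeval fun k => C ((x + st 0 • u + st 1 • v) k) + X k) :
        MvPolynomial σ F →ₐ[F] _) := by
    ext k : 1
    simp only [planeExpansion, AlgHom.comp_apply, aeval_X, map_add, map_mul, mapAlgHom_apply,
      sh, θ, aeval_C, algebraMap_eq, Pi.add_apply, Pi.smul_apply, smul_eq_mul, algebraMap_apply,
      map_C, map_X, RingHom.coe_coe]
    ring
  have h3 := congrArg (coeff i) (DFunLike.congr_fun h2 Q)
  rw [AlgHom.comp_apply, AlgHom.comp_apply] at h3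
  rw [← h3, mapAlgHom_apply, coeff_map] at h1
  exact h1

/-- The coefficient is a polynomial in s, t of degree at most deg Q with N zeros of order M - |i|;
Schwartz-Zippel on F² forces it to vanish. -/
theorem coeff_planeExpansion_eq_zero [Fintype F] {m : ℕ} {x u v : Fin m → F}
    {Q : MvPolynomial (Fin m) F} {M N : ℕ} {P : Finset (Fin 2 → F)} (hP : N ≤ P.card)
    (hvan : ∀ st ∈ P, VanishesToOrder Q (x + st 0 • u + st 1 • v) M) (i : Fin m →₀ ℕ)
    (hi : Q.totalDegree * Fintype.card F < (M - i.degree) * N) :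
    coeff i (planeExpansion x u v Q) = 0 := by
  classical
  by_contra h0
  have h1 := card_mul_sum_le_of_vanishesToOrder (Finset.univ : Finset F) h0
    (fun st => if st ∈ P then M - i.degree else 0) (fun st => by
      split_ifs with h
      · exact vanishesToOrder_coeff_planeExpansion (hvan st h) i
      · simp [VanishesToOrder])
  rw [Fintype.piFinset_univ, Finset.sum_ite_mem, Finset.univ_inter, Finset.sum_const,
    Finset.card_univ, smul_eq_mul] at h1
  have hq : 0 < Fintype.card F := Fintype.card_pos
  have h2 : P.card * (M - i.degree) ≤ Q.totalDegree * Fintype.card F := by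
    refine le_of_mul_le_mul_left ?_ hq
    calc _ ≤ _ := h1
      _ ≤ Q.totalDegree * Fintype.card F ^ 2 :=
        Nat.mul_le_mul_right _ (totalDegree_coeff_planeExpansion_le x u v Q i)
      _ = _ := by ring
  have h3 : (M - i.degree) * N ≤ P.card * (M - i.degree) := by
    rw [mul_comm]; exact Nat.mul_le_mul_right _ hP
  omega

/-- If `Q` vanishes to order `l` along a plane with directions `u, v`, then its top degree part
vanishes to order `l` at the point `u + ω v`. -/
theorem vanishesToOrder_homogeneousComponent_of_plane {x u v : σ → F} {Q : MvPolynomial σ F} {l : ℕ}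
    (h : ∀ i : σ →₀ ℕ, i.degree < l → coeff i (planeExpansion x u v Q) = 0) :
    VanishesToOrder (map Polynomial.C (homogeneousComponent Q.totalDegree Q))
      (fun k => Polynomial.C (u k) + Polynomial.X * Polynomial.C (v k)) l := by
  set e := Q.totalDegree
  set c : σ → Polynomial F := fun k => Polynomial.C (u k) + Polynomial.X * Polynomial.C (v k)
  have hG : planeExpansion x u v Q ∈ idealOfVars σ (MvPolynomial (Fin 2) F) ^ l :=
    (mem_pow_idealOfVars_iff' _ _).2 h
  let B := MvPolynomial σ (Polynomial F)
  -- Substitute s = λ, t = ωλ and Z = λZ, with λ the outer variable and ω that of `Polynomial F`.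
  -- The expansion becomes Q(x + λ(u + ωv + Z)), whose coefficient at λ^e is the top form at u + ωv
  -- + Z.
  let φ : MvPolynomial (Fin 2) F →ₐ[F] Polynomial B :=
    aeval ![Polynomial.X, Polynomial.C (C Polynomial.X) * Polynomial.X]
  let I : Ideal B := idealOfVars σ (Polynomial F)
  let ψ : MvPolynomial σ (MvPolynomial (Fin 2) F) →+* Polynomial B :=
    eval₂Hom φ.toRingHom fun k => Polynomial.X * Polynomial.C (X k)
  have hψ : ψ (planeExpansion x u v Q) ∈ (I ^ l).map Polynomial.C := by
    have h1 : (idealOfVars σ (MvPolynomial (Fin 2) F)).map ψ ≤ I.map Polynomial.C := by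
      rw [idealOfVars, Ideal.map_span, Ideal.span_le]
      rintro _ ⟨_, ⟨k, rfl⟩, rfl⟩
      have : ψ (X k) = Polynomial.X * Polynomial.C (X k) := eval₂Hom_X' _ _ _
      rw [this]
      exact Ideal.mul_mem_left _ _ (Ideal.mem_map_of_mem _ (X_mem_idealOfVars k))
    have h2 := Ideal.mem_map_of_mem ψ hG
    rw [Ideal.map_pow] at h2
    rw [Ideal.map_pow]
    exact Ideal.pow_right_mono h1 l h2
  have h3 : ψ (planeExpansion x u v Q) =
      aeval (fun k => Polynomial.C (C (Polynomial.C (x k)) : B) +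
        Polynomial.C (C (c k) + X k) * Polynomial.X) Q := by
    have : ψ.comp (planeExpansion x u v : MvPolynomial σ F →ₐ[F] _).toRingHom =
        (aeval (fun k => Polynomial.C (C (Polynomial.C (x k)) : B) +
        Polynomial.C (C (c k) + X k) * Polynomial.X) : MvPolynomial σ F →ₐ[F] _).toRingHom := by
      apply MvPolynomial.ringHom_ext
      · intro a
        simp [planeExpansion, ψ, φ, MvPolynomial.algebraMap_apply, Polynomial.algebraMap_apply,
          Polynomial.algebraMap_eq, B]
      · intro k
        simp [planeExpansion, ψ, φ, c, MvPolynomial.algebraMap_apply, Polynomial.algebraMap_apply,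
          Polynomial.algebraMap_eq, B]
        ring
    exact DFunLike.congr_fun this Q
  have h4 := Ideal.mem_map_C_iff.1 hψ e
  rw [h3, coeff_aeval_C_add_C_mul_X le_rfl] at h4
  unfold VanishesToOrder
  convert h4 using 1
  rw [aeval_def, eval₂_map, aeval_def]
  rfl

end Plane

end MvPolynomial

open MvPolynomial in
/-- A set containing many points of a translate of the plane spanned by `u, v`, for many pairs
`(u, v)`, is large. -/
theorem pow_le_card_mul_pow_of_planes {F : Type*} [Field F] [Fintype F] [DecidableEq F] {m : ℕ}
    (T : Finset (Fin m → F)) (D : Finset ((Fin m → F) × (Fin m → F))) {N l j : ℕ} (hN : 0 < N)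
    (hD : ∀ p ∈ D, ∃ x : Fin m → F,
      N ≤ (Finset.univ.filter fun st : Fin 2 → F => x + st 0 • p.1 + st 1 • p.2 ∈ T).card)
    (h : j * N * Fintype.card F ^ (2 * m) < Fintype.card F ^ 2 * l * D.card) :
    (j * N) ^ m ≤ T.card * (l + j * Fintype.card F + m) ^ m := by
  classical
  by_contra! hlt
  obtain ⟨Q, hQ0, hQd, hQT⟩ := exists_vanishesToOrder T (j * N) (l + j * Fintype.card F) hlt
  set q := Fintype.card F
  set H := homogeneousComponent Q.totalDegree Q
  have hH0 : H ≠ 0 := by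
    obtain ⟨i, hi, hsup⟩ := Finset.exists_mem_eq_sup _ (support_nonempty.2 hQ0)
      fun s : Fin m →₀ ℕ => s.sum fun _ e => e
    have hdeg : i.degree = Q.totalDegree := hsup.symm
    intro h0
    have := coeff_homogeneousComponent (n := Q.totalDegree) (φ := Q) (d := i)
    rw [if_pos hdeg] at this
    rw [show homogeneousComponent Q.totalDegree Q = 0 from h0, coeff_zero] at this
    exact mem_support_iff.1 hi this.symm
  set HK := map Polynomial.C H
  have hHK0 : HK ≠ 0 := by
    rw [Ne, map_eq_zero_iff _ (map_injective _ Polynomial.C_injective)]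
    exact hH0
  have hHKd : HK.totalDegree ≤ j * N :=
    ((homogeneousComponent_isHomogeneous Q.totalDegree Q).map Polynomial.C).totalDegree_le.trans hQd
  -- The q² elements a + bω of F[ω] form the side of the grid, so a pair of directions in F^m is
  -- encoded by one grid point.
  let gridPt : F × F → Polynomial F := fun ab =>
    Polynomial.C ab.1 + Polynomial.X * Polynomial.C ab.2
  have hgrid : Function.Injective gridPt := by
    rintro ⟨a, b⟩ ⟨a', b'⟩ hab
    have h0 := congrArg (Polynomial.coeff · 0) hab
    have h1 := congrArg (Polynomial.coeff · 1) hab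
    simp [gridPt, Polynomial.coeff_C] at h0 h1
    rw [h0, h1]
  let S : Finset (Polynomial F) := Finset.univ.image gridPt
  have hS : S.card = q ^ 2 := by
    rw [Finset.card_image_of_injective _ hgrid, Finset.card_univ, Fintype.card_prod, sq]
  let pt : (Fin m → F) × (Fin m → F) → Fin m → Polynomial F := fun p k => gridPt (p.1 k, p.2 k)
  have hpt : Function.Injective pt := by
    rintro ⟨u, v⟩ ⟨u', v'⟩ huv
    have h1 : ∀ k, (u k, v k) = (u' k, v' k) := fun k => hgrid (congrFun huv k)
    simp only [Prod.mk.injEq] at h1 ⊢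
    exact ⟨funext fun k => (h1 k).1, funext fun k => (h1 k).2⟩
  have hvan : ∀ p ∈ D, VanishesToOrder HK (pt p) l := by
    intro p hp
    obtain ⟨x, hx⟩ := hD p hp
    refine vanishesToOrder_homogeneousComponent_of_plane (x := x) fun i hi => ?_
    refine coeff_planeExpansion_eq_zero hx (fun st hst => hQT _ (Finset.mem_filter.1 hst).2) i ?_
    -- For |i| < l at least jq + 1 orders of vanishing remain, just enough to beat the degree bound
    -- jN on a plane.
    have h1 : j * q + 1 ≤ l + j * q - i.degree := by omega
    calc Q.totalDegree * q ≤ j * N * q := Nat.mul_le_mul_right _ hQd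
      _ < (j * q + 1) * N := by nlinarith
      _ ≤ _ := Nat.mul_le_mul_right _ h1
  have h1 := card_mul_sum_le_of_vanishesToOrder S hHK0
    (fun a => if a ∈ D.image pt then l else 0) (fun a => by
      split_ifs with ha
      · obtain ⟨p, hp, rfl⟩ := Finset.mem_image.1 ha
        exact hvan p hp
      · simp [VanishesToOrder])
  have h2 : D.image pt ⊆ Fintype.piFinset fun _ => S := by
    intro a ha
    obtain ⟨p, hp, rfl⟩ := Finset.mem_image.1 ha
    exact Fintype.mem_piFinset.2 fun k => Finset.mem_image_of_mem _ (Finset.mem_univ _)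
  rw [Finset.sum_ite_mem, Finset.inter_eq_right.2 h2, Finset.sum_const,
    Finset.card_image_of_injective _ hpt, smul_eq_mul, hS, ← pow_mul] at h1
  have h3 : HK.totalDegree * q ^ (2 * m) ≤ j * N * q ^ (2 * m) := Nat.mul_le_mul_right _ hHKd
  have h4 : q ^ 2 * (D.card * l) = q ^ 2 * l * D.card := by ring
  omega

/-! ### Second moments for pairwise independent maps -/

section SecondMoment

variable {ι X Y : Type*} [Fintype Y] [DecidableEq Y]

theorem sum_card_fiber_sub_sq (S : Finset X) (f : X → Y) (hY : 0 < Fintype.card Y) :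
    ∑ y, (((S.filter fun x => f x = y).card : ℝ) - S.card / Fintype.card Y) ^ 2 =
      ∑ x ∈ S, ((S.filter fun x' => f x = f x').card : ℝ) - (S.card : ℝ) ^ 2 / Fintype.card Y := by
  have hY' : (Fintype.card Y : ℝ) ≠ 0 := by positivity
  have h1 : ∑ y, ((S.filter fun x => f x = y).card : ℝ) = S.card := by
    rw [Finset.card_eq_sum_card_fiberwise (f := f) (t := Finset.univ) (fun _ _ => by simp)]
    push_cast
    rfl
  have h2 : ∑ y, ((S.filter fun x => f x = y).card : ℝ) ^ 2 =
      ∑ x ∈ S, ((S.filter fun x' => f x = f x').card : ℝ) := by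
    rw [← Finset.sum_fiberwise S f]
    refine Finset.sum_congr rfl fun y _ => ?_
    rw [Finset.sum_congr rfl (g := fun _ => ((S.filter fun x => f x = y).card : ℝ))]
    · rw [Finset.sum_const, nsmul_eq_mul, sq]
    · intro x hx
      rw [(Finset.mem_filter.1 hx).2]
      simp only [eq_comm]
  simp only [sub_sq, Finset.sum_add_distrib, Finset.sum_sub_distrib, ← Finset.sum_mul,
    ← Finset.mul_sum, h1, h2, Finset.sum_const, Finset.card_univ, nsmul_eq_mul]
  field_simp
  ring

/-- The second moment bound for a pairwise independent family of maps. -/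
theorem sum_sum_card_fiber_sub_sq_le (Φ : Finset ι) (f : ι → X → Y) (S : Finset X)
    (hY : 0 < Fintype.card Y)
    (h : ∀ x ∈ S, ∀ x' ∈ S, x ≠ x' →
      Fintype.card Y * (Φ.filter fun i => f i x = f i x').card ≤ Φ.card) :
    ∑ i ∈ Φ, ∑ y, (((S.filter fun x => f i x = y).card : ℝ) - S.card / Fintype.card Y) ^ 2 ≤
      Φ.card * S.card := by
  classical
  have hY' : (0 : ℝ) < Fintype.card Y := by exact_mod_cast hY
  simp only [sum_card_fiber_sub_sq S _ hY, Finset.sum_sub_distrib, Finset.sum_const, nsmul_eq_mul]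
  have h1 : ∑ i ∈ Φ, ∑ x ∈ S, ((S.filter fun x' => f i x = f i x').card : ℝ) =
      ∑ x ∈ S, ∑ x' ∈ S, ((Φ.filter fun i => f i x = f i x').card : ℝ) := by
    simp only [Finset.card_filter, Nat.cast_sum]
    rw [Finset.sum_comm]
    exact Finset.sum_congr rfl fun x _ => Finset.sum_comm
  have h2 : ∀ x ∈ S, ∑ x' ∈ S, ((Φ.filter fun i => f i x = f i x').card : ℝ) ≤
      Φ.card + S.card * (Φ.card / Fintype.card Y) := by
    intro x hx
    rw [← Finset.add_sum_erase S _ hx]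
    have h3 : ∑ x' ∈ S.erase x, ((Φ.filter fun i => f i x = f i x').card : ℝ) ≤
        ∑ x' ∈ S.erase x, ((Φ.card : ℝ) / Fintype.card Y) := by
      refine Finset.sum_le_sum fun x' hx' => ?_
      rw [le_div_iff₀ hY', mul_comm]
      exact_mod_cast h x hx x' (Finset.mem_of_mem_erase hx') (Finset.ne_of_mem_erase hx').symm
    rw [Finset.sum_const, nsmul_eq_mul] at h3
    have h4 : ((S.erase x).card : ℝ) * ((Φ.card : ℝ) / Fintype.card Y) ≤
        S.card * ((Φ.card : ℝ) / Fintype.card Y) := by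
      have : (S.erase x).card ≤ S.card := Finset.card_le_card (Finset.erase_subset _ _)
      gcongr
    have h5 : (Φ.filter fun i => f i x = f i x).card = Φ.card := by simp
    rw [h5]
    linarith
  rw [h1]
  have h6 := Finset.sum_le_sum h2
  rw [Finset.sum_const, nsmul_eq_mul] at h6
  have h7 : (S.card : ℝ) * (Φ.card + S.card * (Φ.card / Fintype.card Y)) -
      Φ.card * ((S.card : ℝ) ^ 2 / Fintype.card Y) = Φ.card * S.card := by
    field_simp
    ring
  linarith

/-- Chebyshev's inequality for the fibre sizes of a pairwise independent family of maps. -/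
theorem sum_card_deviating_fibers_le (Φ : Finset ι) (f : ι → X → Y) (S : Finset X)
    (hY : 0 < Fintype.card Y)
    (h : ∀ x ∈ S, ∀ x' ∈ S, x ≠ x' →
      Fintype.card Y * (Φ.filter fun i => f i x = f i x').card ≤ Φ.card) {c : ℝ} (hc : 0 ≤ c) :
    (∑ i ∈ Φ, ((Finset.univ.filter fun y : Y =>
      c ≤ |((S.filter fun x => f i x = y).card : ℝ) - S.card / Fintype.card Y|).card : ℝ)) * c ^ 2 ≤
      Φ.card * S.card := by
  refine le_trans ?_ (sum_sum_card_fiber_sub_sq_le Φ f S hY h)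
  rw [Finset.sum_mul]
  refine Finset.sum_le_sum fun i _ => ?_
  rw [← nsmul_eq_mul, ← Finset.sum_const]
  refine (Finset.sum_le_sum fun y hy => ?_).trans
    (Finset.sum_le_sum_of_subset_of_nonneg (Finset.filter_subset _ _) fun y _ _ => sq_nonneg _)
  rw [← sq_abs (_ - _)]
  exact pow_le_pow_left₀ hc (Finset.mem_filter.1 hy).2 2

end SecondMoment

/-! ### Random linear maps -/

section RandomLinearMap

variable {F V W U : Type*} [Field F] [AddCommGroup V] [Module F V] [AddCommGroup W] [Module F W]
  [AddCommGroup U] [Module F U]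

/-- If a set of linear maps is invariant under adding maps through `L`, then a random member takes
a given value at a given nonzero vector with probability at most `1 / |U|`. -/
theorem card_mul_card_filter_apply_eq_le [Fintype U] [DecidableEq W] (L : U →ₗ[F] W)
    (hL : Function.Injective L) (Φ : Finset (V →ₗ[F] W))
    (hΦ : ∀ φ ∈ Φ, ∀ ψ : V →ₗ[F] U, φ + L ∘ₗ ψ ∈ Φ) {x : V} (hx : x ≠ 0) (w : W) :
    Fintype.card U * (Φ.filter fun φ => φ x = w).card ≤ Φ.card := by
  classical
  obtain ⟨ξ, hξ⟩ := Module.Projective.exists_dual_ne_zero F hx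
  -- Rank-one maps with prescribed value u at x: adding `L ∘ₗ ψ u` moves the value at x from w to w
  -- + L u, giving |U| disjoint copies of the fibre inside `Φ`.
  let ψ : U → V →ₗ[F] U := fun u => ξ.smulRight ((ξ x)⁻¹ • u)
  have hψ : ∀ u, ψ u x = u := fun u => by simp [ψ, smul_smul, hξ]
  rw [← Finset.card_univ, ← Finset.card_product]
  refine Finset.card_le_card_of_injOn (fun p => p.2 + L ∘ₗ ψ p.1) ?_ ?_
  · rintro ⟨u, φ⟩ hp
    simp only [Finset.coe_product, Set.mem_prod, Finset.mem_coe, Finset.mem_filter] at hp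
    exact hΦ φ hp.2.1 _
  · rintro ⟨u, φ⟩ hp ⟨u', φ'⟩ hp' heq
    simp only [Finset.coe_product, Set.mem_prod, Finset.mem_coe, Finset.mem_filter] at hp hp'
    have h1 := LinearMap.congr_fun heq x
    simp only [LinearMap.add_apply, LinearMap.comp_apply, hψ, hp.2.2, hp'.2.2,
      add_right_inj] at h1
    have h2 : u = u' := hL h1
    subst h2
    simpa using heq

theorem Submodule.exists_linearEquiv_comap_eq [FiniteDimensional F V] {A B : Submodule F V}
    (h : Module.finrank F A = Module.finrank F B) :
    ∃ e : V ≃ₗ[F] V, B.comap e.toLinearMap = A := by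
  obtain ⟨A', hA⟩ := A.exists_isCompl
  obtain ⟨B', hB⟩ := B.exists_isCompl
  have h' : Module.finrank F A' = Module.finrank F B' := by
    have h1 := Submodule.finrank_add_eq_of_isCompl hA
    have h2 := Submodule.finrank_add_eq_of_isCompl hB
    omega
  let e : V ≃ₗ[F] V := (A.prodEquivOfIsCompl A' hA).symm.trans
    (((LinearEquiv.ofFinrankEq _ _ h).prodCongr (LinearEquiv.ofFinrankEq _ _ h')).trans
      (B.prodEquivOfIsCompl B' hB))
  have hle : A ≤ B.comap e.toLinearMap := by
    intro x hx
    have h1 : (A.prodEquivOfIsCompl A' hA).symm x = (⟨x, hx⟩, 0) :=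
      Submodule.prodEquivOfIsCompl_symm_apply_left A A' hA ⟨x, hx⟩
    simp [e, h1]
  refine ⟨e, (Submodule.eq_of_le_of_finrank_eq hle ?_).symm⟩
  have h2 : B.comap e.toLinearMap = B.map e.symm.toLinearMap := by
    ext x
    simp
  rw [h2, h]
  exact (e.symm.finrank_map_eq B).symm

/-- Precomposition with an automorphism carrying A to B is a bijection between the two sets of maps.
Hence the preimage of P, given its dimension, is uniformly distributed. -/
theorem card_filter_comap_eq_of_finrank_eq [FiniteDimensional F V] [Fintype (V →ₗ[F] W)]
    [DecidableEq (Submodule F V)] (P : Submodule F W) {A B : Submodule F V}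
    (h : Module.finrank F A = Module.finrank F B) :
    (Finset.univ.filter fun φ : V →ₗ[F] W => P.comap φ = A).card =
      (Finset.univ.filter fun φ : V →ₗ[F] W => P.comap φ = B).card := by
  obtain ⟨e, he⟩ := Submodule.exists_linearEquiv_comap_eq h
  symm
  refine Finset.card_bij' (fun φ _ => φ ∘ₗ e.toLinearMap) (fun φ _ => φ ∘ₗ e.symm.toLinearMap)
    ?_ ?_ ?_ ?_
  · intro φ hφ
    simp only [Finset.mem_filter, Finset.mem_univ, true_and] at hφ ⊢
    rw [Submodule.comap_comp, hφ, he]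
  · intro φ hφ
    simp only [Finset.mem_filter, Finset.mem_univ, true_and] at hφ ⊢
    rw [Submodule.comap_comp, hφ, ← he, ← Submodule.comap_comp]
    simp
  · intro φ _; ext; simp
  · intro φ _; ext; simp

theorem finrank_le_finrank_comap_add [FiniteDimensional F V] [FiniteDimensional F W]
    (P : Submodule F W) (φ : V →ₗ[F] W) :
    Module.finrank F V + Module.finrank F P ≤
      Module.finrank F (P.comap φ) + Module.finrank F W := by
  have h1 := (P.mkQ ∘ₗ φ).finrank_range_add_finrank_ker
  have h2 : LinearMap.ker (P.mkQ ∘ₗ φ) = P.comap φ := by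
    rw [LinearMap.ker_comp, Submodule.ker_mkQ]
  have h3 := Submodule.finrank_le (LinearMap.range (P.mkQ ∘ₗ φ))
  have h4 := P.finrank_quotient_add_finrank
  rw [h2] at h1
  omega

/-- The preimage of a subspace under a random linear map rarely has larger dimension than
expected. -/
theorem card_finrank_comap_ne_mul_le [Fintype F] [Fintype V] [Fintype W] [DecidableEq W]
    [Fintype (V →ₗ[F] W)] (P : Submodule F W) {k : ℕ}
    (hk : k + Module.finrank F W = Module.finrank F V + Module.finrank F P) :
    (Finset.univ.filter fun φ : V →ₗ[F] W => Module.finrank F (P.comap φ) ≠ k).card *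
      (Fintype.card F ^ k * (Fintype.card F - 1)) ≤ Fintype.card (V →ₗ[F] W) := by
  classical
  set q := Fintype.card F with hq
  have hq0 : 0 < q := Fintype.card_pos
  have hcardP : (Finset.univ.filter fun w : W => w ∈ P).card = q ^ Module.finrank F P := by
    rw [← Module.card_eq_pow_finrank (K := F) (V := P), Fintype.card_subtype]
  -- The preimage has mean size at most 1 + q^k, where the 1 is the vector 0. It never has fewer
  -- than q^k elements and has at least q^(k+1) in the exceptional case, so Markov's inequality
  -- applies to the excess.
  have hsum : ∑ φ : V →ₗ[F] W, Fintype.card (P.comap φ) ≤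
      Fintype.card (V →ₗ[F] W) + Fintype.card (V →ₗ[F] W) * q ^ k := by
    have h1 : ∑ φ : V →ₗ[F] W, Fintype.card (P.comap φ) =
        ∑ x : V, (Finset.univ.filter fun φ : V →ₗ[F] W => φ x ∈ P).card := by
      simp only [Finset.card_filter]
      rw [Finset.sum_comm]
      refine Finset.sum_congr rfl fun φ _ => ?_
      rw [← Finset.card_filter, Fintype.card_subtype]
      rfl
    have h2 : ∀ x : V, x ≠ 0 → q ^ Module.finrank F W *
        (Finset.univ.filter fun φ : V →ₗ[F] W => φ x ∈ P).card ≤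
        q ^ Module.finrank F P * Fintype.card (V →ₗ[F] W) := by
      intro x hx
      have h3 : (Finset.univ.filter fun φ : V →ₗ[F] W => φ x ∈ P).card =
          ∑ w ∈ Finset.univ.filter fun w : W => w ∈ P,
            (Finset.univ.filter fun φ : V →ₗ[F] W => φ x = w).card := by
        rw [Finset.card_eq_sum_card_fiberwise (f := fun φ => φ x)
          (t := Finset.univ.filter fun w : W => w ∈ P) (fun φ hφ => by simpa using hφ)]
        refine Finset.sum_congr rfl fun w hw => ?_
        congr 1
        ext φ
        simp only [Finset.mem_filter, Finset.mem_univ, true_and] at hw ⊢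
        exact ⟨fun h => h.2, fun h => ⟨h ▸ hw, h⟩⟩
      rw [h3, Finset.mul_sum, ← hcardP, ← smul_eq_mul (a := Finset.card _), ← Finset.sum_const,
        ← Module.card_eq_pow_finrank (K := F) (V := W)]
      exact Finset.sum_le_sum fun w _ => card_mul_card_filter_apply_eq_le LinearMap.id
        Function.injective_id Finset.univ (fun _ _ _ => Finset.mem_univ _) hx w
    rw [h1, ← Finset.add_sum_erase _ _ (Finset.mem_univ (0 : V))]
    refine Nat.add_le_add (Finset.card_le_univ _) ?_
    refine Nat.le_of_mul_le_mul_left ?_ (pow_pos hq0 (Module.finrank F W))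
    rw [Finset.mul_sum]
    refine (Finset.sum_le_sum fun x hx => h2 x (Finset.ne_of_mem_erase hx)).trans ?_
    rw [Finset.sum_const, smul_eq_mul]
    calc (Finset.univ.erase (0 : V)).card * (q ^ Module.finrank F P * Fintype.card (V →ₗ[F] W))
        ≤ q ^ Module.finrank F V * (q ^ Module.finrank F P * Fintype.card (V →ₗ[F] W)) := by
          refine Nat.mul_le_mul_right _ ?_
          rw [← Module.card_eq_pow_finrank (K := F) (V := V)]
          exact Finset.card_le_univ _
      _ = q ^ (Module.finrank F V + Module.finrank F P) * Fintype.card (V →ₗ[F] W) := by ring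
      _ = q ^ Module.finrank F W * (Fintype.card (V →ₗ[F] W) * q ^ k) := by rw [← hk]; ring
  have hlow : ∀ φ : V →ₗ[F] W, q ^ k + (if Module.finrank F (P.comap φ) ≠ k then
      q ^ k * (q - 1) else 0) ≤ Fintype.card (P.comap φ) := by
    intro φ
    rw [Module.card_eq_pow_finrank (K := F) (V := P.comap φ), ← hq]
    have := finrank_le_finrank_comap_add P φ
    have hle : k ≤ Module.finrank F (P.comap φ) := by omega
    split_ifs with h
    · calc q ^ k + q ^ k * (q - 1) = q ^ (k + 1) := by
            rw [pow_succ, ← mul_one_add, show 1 + (q - 1) = q by omega]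
        _ ≤ _ := Nat.pow_le_pow_right hq0 (by omega)
    · simpa using Nat.pow_le_pow_right hq0 hle
  have h5 := (Finset.sum_le_sum fun φ (_ : φ ∈ Finset.univ) => hlow φ).trans hsum
  rw [Finset.sum_add_distrib, Finset.sum_const, ← Finset.sum_filter, Finset.sum_const,
    Finset.card_univ, smul_eq_mul, smul_eq_mul] at h5
  omega

end RandomLinearMap

/-! ### Choosing few maps that catch most planes -/

section Covering

/-- If every member of `G` is caught by a random `i` with probability at least `p`, then `N`
suitable choices miss few members of `G` at a small total cost. -/
theorem exists_covering_choice {ι P : Type*} [Fintype ι] [Nonempty ι] [DecidableEq P]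
    (W : P → ι → Prop) [∀ a i, Decidable (W a i)] (cost : ι → ℝ) {ε p κ : ℝ} (hp : p ≤ 1)
    (hκ : 0 ≤ κ) (hcost : ∑ i, cost i ≤ Fintype.card ι * ε) (N : ℕ) (G : Finset P)
    (hG : ∀ a ∈ G, p * Fintype.card ι ≤ (Finset.univ.filter fun i => W a i).card) :
    ∃ f : Fin N → ι, ∑ s, cost (f s) + κ * (G.filter fun a => ∀ s, ¬ W a (f s)).card ≤
      N * ε + κ * (G.card * (1 - p) ^ N) := by
  induction N generalizing G with
  | zero =>
    refine ⟨Fin.elim0, ?_⟩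
    simp
  | succ N ih =>
    have hcaught : ∑ i, ((G.filter fun a => ¬ W a i).card : ℝ) ≤
        G.card * ((1 - p) * Fintype.card ι) := by
      have h1 : ∑ i, ((G.filter fun a => ¬ W a i).card : ℝ) =
          ∑ a ∈ G, ((Finset.univ.filter fun i => ¬ W a i).card : ℝ) := by
        simp only [Finset.card_filter, Nat.cast_sum]
        exact Finset.sum_comm
      rw [h1, ← nsmul_eq_mul, ← Finset.sum_const]
      refine Finset.sum_le_sum fun a ha => ?_
      have h2 := Finset.card_filter_add_card_filter_not (s := (Finset.univ : Finset ι)) (W a)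
      have h3 : ((Finset.univ.filter fun i => W a i).card : ℝ) +
          (Finset.univ.filter fun i => ¬ W a i).card = Fintype.card ι := by exact_mod_cast h2
      linarith [hG a ha]
    -- Conditional expectations: choose i with its cost plus the expected penalty after N further
    -- random choices at most average.
    obtain ⟨i, -, hi⟩ := Finset.exists_le_of_sum_le (s := (Finset.univ : Finset ι))
      Finset.univ_nonempty
      (f := fun i => cost i + κ * (1 - p) ^ N * ((G.filter fun a => ¬ W a i).card : ℝ))
      (g := fun _ => ε + κ * (G.card * (1 - p) ^ (N + 1))) (by
        rw [Finset.sum_add_distrib, ← Finset.mul_sum, Finset.sum_const, Finset.card_univ,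
          nsmul_eq_mul]
        have h4 : 0 ≤ κ * (1 - p) ^ N := mul_nonneg hκ (pow_nonneg (by linarith) _)
        have h5 := mul_le_mul_of_nonneg_left hcaught h4
        calc _ ≤ Fintype.card ι * ε + κ * (1 - p) ^ N * (G.card * ((1 - p) * Fintype.card ι)) :=
              add_le_add hcost h5
          _ = _ := by ring)
    obtain ⟨f, hf⟩ := ih (G.filter fun a => ¬ W a i) fun a ha => hG a (Finset.mem_filter.1 ha).1
    refine ⟨Fin.cons i f, ?_⟩
    rw [Fin.sum_univ_succ]
    have h6 : (G.filter fun a => ∀ s, ¬ W a ((Fin.cons i f : Fin (N + 1) → ι) s)) =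
        (G.filter fun a => ¬ W a i).filter fun a => ∀ s, ¬ W a (f s) := by
      ext a
      simp [Finset.mem_filter, Fin.forall_fin_succ, and_assoc]
    rw [h6]
    simp only [Fin.cons_zero, Fin.cons_succ]
    push_cast
    linarith

end Covering

/-- The polynomial bound gives |T| ≥ (N / (q + 3))^m with N about (1 - 2ε)q². This is q^m times (1 -
O(ε + 1/q))^m, and Bernoulli's inequality keeps that factor above 1/2. -/
theorem card_lt_two_mul_card_of_planes {F : Type*} [Field F] [Fintype F] [DecidableEq F] {m : ℕ}
    (T : Finset (Fin m → F)) (D : Finset ((Fin m → F) × (Fin m → F))) {ε : ℝ} (hε : 0 ≤ ε)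
    (hm : 0 < m) (hsmall : m * (2 * ε + 3 / Fintype.card F) < 1 / 2)
    (hD : ∀ p ∈ D, ∃ x : Fin m → F, (1 - 2 * ε) * (Fintype.card F : ℝ) ^ 2 ≤
      (Finset.univ.filter fun st : Fin 2 → F => x + st 0 • p.1 + st 1 • p.2 ∈ T).card)
    (hcard : Fintype.card F ^ (2 * m) ≤ 2 * D.card) :
    Fintype.card F ^ m < 2 * T.card := by
  set q := Fintype.card F with hq
  have hq0 : 0 < q := Fintype.card_pos
  have hqR : (0 : ℝ) < q := by exact_mod_cast hq0
  have hmR : (1 : ℝ) ≤ m := by exact_mod_cast hm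
  have h3q : 0 < 3 / (q : ℝ) := by positivity
  have hsum : 2 * ε + 3 / (q : ℝ) < 1 / 2 := by nlinarith
  set N := ⌈(1 - 2 * ε) * (q : ℝ) ^ 2⌉₊ with hN
  have hN0 : 0 < N := Nat.ceil_pos.2 (mul_pos (by linarith) (by positivity))
  have hNq : N ≤ q ^ 2 := by
    refine Nat.ceil_le.2 ?_
    push_cast
    have : (0 : ℝ) ≤ (q : ℝ) ^ 2 := by positivity
    nlinarith
  have hNle : (1 - 2 * ε) * (q : ℝ) ^ 2 ≤ N := Nat.le_ceil _
  -- With j = m + 1, the choice l = 2j + 1 just exceeds 2j, as |D| ≥ q^(2m) / 2 requires, and l + jq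
  -- + m = j(q + 3), so that j^m cancels.
  have key := pow_le_card_mul_pow_of_planes T D (N := N) (l := 2 * (m + 1) + 1) (j := m + 1) hN0
    (fun p hp => by
      obtain ⟨x, hx⟩ := hD p hp
      exact ⟨x, Nat.ceil_le.2 hx⟩) (by
      have hpos : 0 < q ^ 2 * q ^ (2 * m) := by positivity
      calc (m + 1) * N * q ^ (2 * m) ≤ (m + 1) * q ^ 2 * q ^ (2 * m) := by gcongr
        _ < q ^ 2 * (2 * (m + 1) + 1) * D.card := by
          have h1 : q ^ 2 * q ^ (2 * m) ≤ q ^ 2 * (2 * D.card) := Nat.mul_le_mul_left _ hcard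
          nlinarith)
  rw [← hq, show 2 * (m + 1) + 1 + (m + 1) * q + m = (m + 1) * (q + 3) by ring, mul_pow, mul_pow,
    mul_left_comm] at key
  have key2 : N ^ m ≤ T.card * (q + 3) ^ m := Nat.le_of_mul_le_mul_left key (by positivity)
  by_contra! hT
  have h1 : 2 * N ^ m ≤ (q * (q + 3)) ^ m := by
    rw [mul_pow]
    calc 2 * N ^ m ≤ 2 * T.card * (q + 3) ^ m := by linarith
      _ ≤ _ := Nat.mul_le_mul_right _ hT
  have h1R : 2 * (N : ℝ) ^ m ≤ ((q : ℝ) * (q + 3)) ^ m := by exact_mod_cast h1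
  have h2 : (1 - (2 * ε + 3 / q)) * ((q : ℝ) * (q + 3)) ≤ N := by
    refine le_trans ?_ hNle
    have h4 : (1 - (2 * ε + 3 / q)) * ((q : ℝ) * (q + 3)) =
        (1 - 2 * ε) * (q : ℝ) ^ 2 - 6 * ε * q - 9 := by
      field_simp
      ring
    rw [h4]
    have : 0 ≤ 6 * ε * q := by positivity
    linarith
  have h3 : ((1 - (2 * ε + 3 / q)) * ((q : ℝ) * (q + 3))) ^ m ≤ (N : ℝ) ^ m :=
    pow_le_pow_left₀ (mul_nonneg (by linarith) (by positivity)) h2 m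
  have h4 : 1 + (m : ℝ) * (-(2 * ε + 3 / q)) ≤ (1 + -(2 * ε + 3 / q)) ^ m :=
    one_add_mul_le_pow (by linarith) m
  rw [mul_pow, sub_eq_add_neg] at h3
  have h5 : 0 < ((q : ℝ) * (q + 3)) ^ m := by positivity
  nlinarith

/-! ### Fibres over a plane coming from an unbalanced translate -/

section BadSubspace

variable {F V W U : Type*} [Field F] [AddCommGroup V] [Module F V] [AddCommGroup W] [Module F W]
  [AddCommGroup U] [Module F U]

/-- If a translate `a + A` has an unexpected number of points of `S`, then so do most of the fibres
into which a random linear map with `φ ⁻¹ (range L) = A` cuts it. -/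
theorem sum_card_balanced_fibers_le [Fintype U] [DecidableEq V] [DecidableEq W]
    (L : U →ₗ[F] W) (hL : Function.Injective L) (A : Submodule F V) [DecidablePred (· ∈ A)]
    (Φ : Finset (V →ₗ[F] W)) (hΦ : ∀ φ, φ ∈ Φ ↔ (LinearMap.range L).comap φ = A) (S : Finset V)
    (a : V) {τ μ : ℝ} (hτ : 0 < τ) (hμ : 0 < μ)
    (hbad : τ * (μ * Fintype.card U) <
      |((S.filter fun x => x - a ∈ A).card : ℝ) - μ * Fintype.card U|) :
    ∑ φ ∈ Φ, ((Finset.univ.filter fun u : U =>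
      ¬ τ / 2 * μ ≤ |((S.filter fun x => φ x = φ a + L u).card : ℝ) - μ|).card : ℝ) ≤
      4 * (1 + τ) / (τ ^ 2 * μ) * Fintype.card U * Φ.card := by
  classical
  obtain ⟨g, hg⟩ := L.exists_leftInverse_of_injective (LinearMap.ker_eq_bot.2 hL)
  have hgL : ∀ u, g (L u) = u := fun u => LinearMap.congr_fun hg u
  set S' := S.filter fun x => x - a ∈ A
  have hU : 0 < Fintype.card U := Fintype.card_pos
  have hUR : (0 : ℝ) < Fintype.card U := by exact_mod_cast hU
  have hmem : ∀ φ ∈ Φ, ∀ x, x - a ∈ A ↔ ∃ u, L u = φ (x - a) := by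
    intro φ hφ x
    rw [← (hΦ φ).1 hφ]
    rfl
  have hinv : ∀ φ ∈ Φ, ∀ ψ : V →ₗ[F] U, φ + L ∘ₗ ψ ∈ Φ := by
    intro φ hφ ψ
    rw [hΦ] at hφ ⊢
    rw [← hφ]
    ext x
    simp only [Submodule.mem_comap, LinearMap.add_apply, LinearMap.comp_apply]
    exact (LinearMap.range L).add_mem_iff_left (LinearMap.mem_range_self L _)
  have hpair : ∀ x ∈ S', ∀ x' ∈ S', x ≠ x' → Fintype.card U *
      (Φ.filter fun φ => g (φ (x - a)) = g (φ (x' - a))).card ≤ Φ.card := by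
    intro x hx x' hx' hne
    refine le_trans (Nat.mul_le_mul_left _ (Finset.card_le_card fun φ hφ => ?_))
      (card_mul_card_filter_apply_eq_le L hL Φ hinv (sub_ne_zero.2 hne) 0)
    rw [Finset.mem_filter] at hφ ⊢
    obtain ⟨u, hu⟩ := (hmem φ hφ.1 x).1 (Finset.mem_filter.1 hx).2
    obtain ⟨u', hu'⟩ := (hmem φ hφ.1 x').1 (Finset.mem_filter.1 hx').2
    refine ⟨hφ.1, ?_⟩
    have h1 := hφ.2
    rw [← hu, ← hu', hgL, hgL] at h1
    rw [h1, hu'] at hu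
    rw [← sub_sub_sub_cancel_right x x' a, map_sub, hu, sub_self]
  set s : ℝ := S'.card / Fintype.card U with hs
  set d : ℝ := |s - μ| with hd
  have hSs : (S'.card : ℝ) = s * Fintype.card U := by rw [hs]; field_simp
  have hdτ : τ * μ < d := by
    -- Here s is the mean fibre size inside a + A, and the imbalance says that it is farther than τμ
    -- from μ.
    rw [hSs, ← sub_mul, abs_mul, abs_of_pos hUR, ← mul_assoc] at hbad
    exact lt_of_mul_lt_mul_right hbad hUR.le
  have hd0 : 0 < d := lt_trans (by positivity) hdτ
  have hsle : s ≤ μ + d := by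
    have := le_abs_self (s - μ)
    linarith
  have hcheb := sum_card_deviating_fibers_le Φ (fun φ x => g (φ (x - a))) S' hU hpair
    (c := d / 2) (by linarith)
  have hle : ∑ φ ∈ Φ, ((Finset.univ.filter fun u : U =>
      ¬ τ / 2 * μ ≤ |((S.filter fun x => φ x = φ a + L u).card : ℝ) - μ|).card : ℝ) ≤
      ∑ φ ∈ Φ, ((Finset.univ.filter fun u : U =>
      d / 2 ≤ |((S'.filter fun x => g (φ (x - a)) = u).card : ℝ) - s|).card : ℝ) := by
    refine Finset.sum_le_sum fun φ hφ => Nat.cast_le.2 (Finset.card_le_card fun u hu => ?_)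
    rw [Finset.mem_filter] at hu ⊢
    refine ⟨hu.1, ?_⟩
    have h1 : (S'.filter fun x => g (φ (x - a)) = u) = S.filter fun x => φ x = φ a + L u := by
      ext x
      rw [Finset.mem_filter, Finset.mem_filter, Finset.mem_filter, and_assoc]
      refine and_congr_right fun _ => ⟨?_, ?_⟩
      · rintro ⟨hx, rfl⟩
        obtain ⟨u, hu⟩ := (hmem φ hφ x).1 hx
        rw [← hu, hgL, hu, map_sub]
        abel
      · intro hx
        have h2 : L u = φ (x - a) := by rw [map_sub, hx]; abel
        exact ⟨(hmem φ hφ x).2 ⟨u, h2⟩, by rw [← h2, hgL]⟩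
    rw [h1]
    -- A fibre within τμ/2 of μ is farther than d - τμ/2 > d/2 from the mean s.
    have h2 := not_le.1 hu.2
    have h3 := abs_sub_le s ((S.filter fun x => φ x = φ a + L u).card : ℝ) μ
    rw [abs_sub_comm s ((S.filter fun x => φ x = φ a + L u).card : ℝ)] at h3
    linarith
  refine hle.trans ?_
  have hd2 : 0 < (d / 2) ^ 2 := by positivity
  refine le_of_mul_le_mul_right (hcheb.trans ?_) hd2
  rw [hSs]
  -- Since s ≤ μ + d, the Chebyshev ratio is at most 4(μ + d)/d², which decreases in d; the constant
  -- is its value at d = τμ.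
  have h1 : s ≤ 4 * (1 + τ) / (τ ^ 2 * μ) * (d / 2) ^ 2 := by
    have h2 : 4 * (1 + τ) / (τ ^ 2 * μ) * (d / 2) ^ 2 = (1 + τ) * d ^ 2 / (τ ^ 2 * μ) := by ring
    rw [h2, le_div_iff₀ (by positivity)]
    have h3 : (τ * μ) ^ 2 ≤ d ^ 2 := pow_le_pow_left₀ (by positivity) hdτ.le 2
    have h4 : τ * d * (τ * μ) ≤ τ * d * d := mul_le_mul_of_nonneg_left hdτ.le (by positivity)
    have h5 : s * (τ ^ 2 * μ) ≤ (μ + d) * (τ ^ 2 * μ) :=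
      mul_le_mul_of_nonneg_right hsle (by positivity)
    nlinarith
  calc (Φ.card : ℝ) * (s * Fintype.card U)
      ≤ Φ.card * (4 * (1 + τ) / (τ ^ 2 * μ) * (d / 2) ^ 2 * Fintype.card U) :=
        mul_le_mul_of_nonneg_left (mul_le_mul_of_nonneg_right h1 hUR.le) (Nat.cast_nonneg _)
    _ = _ := by ring

/-- Markov's inequality at twice the bound on the mean. -/
theorem Finset.card_le_two_mul_card_filter_of_sum_le {ι : Type*} (Φ : Finset ι) (g : ι → ℝ)
    (hg : ∀ i ∈ Φ, 0 ≤ g i) {b : ℝ} (hb : 0 < b) (h : ∑ i ∈ Φ, g i ≤ b * Φ.card)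
    [DecidablePred fun i => g i ≤ 2 * b] :
    (Φ.card : ℝ) ≤ 2 * (Φ.filter fun i => g i ≤ 2 * b).card := by
  have h1 : ((Φ.filter fun i => ¬ g i ≤ 2 * b).card : ℝ) * (2 * b) ≤ ∑ i ∈ Φ, g i := by
    rw [← nsmul_eq_mul, ← Finset.sum_const]
    exact (Finset.sum_le_sum fun i hi => (not_le.1 (Finset.mem_filter.1 hi).2).le).trans
      (Finset.sum_le_sum_of_subset_of_nonneg (Finset.filter_subset _ _) fun i hi _ => hg i hi)
  have h2 : ((Φ.filter fun i => g i ≤ 2 * b).card : ℝ) +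
      (Φ.filter fun i => ¬ g i ≤ 2 * b).card = Φ.card := by
    exact_mod_cast Finset.card_filter_add_card_filter_not _
  have h3 : ((Φ.filter fun i => ¬ g i ≤ 2 * b).card : ℝ) * 2 ≤ Φ.card := by
    refine le_of_mul_le_mul_right ?_ hb
    linarith
  linarith

end BadSubspace

/-! ### Planes spanned by pairs of vectors, and the probability of catching one -/

section PlaneMap

variable {F : Type*} [Field F] {m : ℕ}

/-- The linear map `(s, t) ↦ s u + t v`. -/
def planeMap (u v : Fin m → F) : (Fin 2 → F) →ₗ[F] (Fin m → F) :=
  (LinearMap.proj 0).smulRight u + (LinearMap.proj 1).smulRight v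

theorem planeMap_apply (u v : Fin m → F) (st : Fin 2 → F) :
    planeMap u v st = st 0 • u + st 1 • v := rfl

/-- In a dependent pair one vector is a multiple of the other, which leaves q^(m+1) choices for each
order. -/
theorem card_not_injective_planeMap_le [Fintype F] [DecidableEq F]
    [DecidablePred fun p : (Fin m → F) × (Fin m → F) => ¬ Function.Injective (planeMap p.1 p.2)] :
    (Finset.univ.filter fun p : (Fin m → F) × (Fin m → F) =>
      ¬ Function.Injective (planeMap p.1 p.2)).card ≤ 2 * Fintype.card F ^ (m + 1) := by
  classical
  let f : (Fin m → F) × F → (Fin m → F) × (Fin m → F) := fun p => (p.1, p.2 • p.1)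
  let g : (Fin m → F) × F → (Fin m → F) × (Fin m → F) := fun p => (p.2 • p.1, p.1)
  have hsub : (Finset.univ.filter fun p : (Fin m → F) × (Fin m → F) =>
      ¬ Function.Injective (planeMap p.1 p.2)) ⊆ Finset.univ.image f ∪ Finset.univ.image g := by
    rintro ⟨u, v⟩ hp
    simp only [Finset.mem_filter, Finset.mem_univ, true_and] at hp
    rw [← LinearMap.ker_eq_bot, LinearMap.ker_eq_bot'] at hp
    push Not at hp
    obtain ⟨st, h0, hne⟩ := hp
    rw [planeMap_apply] at h0
    rw [Finset.mem_union, Finset.mem_image, Finset.mem_image]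
    by_cases h1 : st 1 = 0
    · have h2 : st 0 ≠ 0 := by
        intro h2
        apply hne
        ext i
        fin_cases i
        · exact h2
        · exact h1
      rw [h1, zero_smul, add_zero] at h0
      have hu : u = 0 := (smul_eq_zero.1 h0).resolve_left h2
      exact Or.inr ⟨(v, 0), Finset.mem_univ _, by simp [g, hu]⟩
    · refine Or.inl ⟨(u, -((st 1)⁻¹ * st 0)), Finset.mem_univ _, ?_⟩
      have h2 : st 1 • v = -(st 0 • u) := (neg_eq_of_add_eq_zero_right h0).symm
      have h3 : v = (st 1)⁻¹ • (-(st 0 • u)) := by rw [← h2, smul_smul, inv_mul_cancel₀ h1, one_smul]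
      simp only [f, Prod.mk.injEq, true_and]
      rw [h3, smul_neg, smul_smul, neg_smul]
  refine (Finset.card_le_card hsub).trans ((Finset.card_union_le _ _).trans ?_)
  have hcard : Fintype.card ((Fin m → F) × F) = Fintype.card F ^ (m + 1) := by
    simp [pow_succ]
  have h1 := (Finset.card_image_le (s := Finset.univ) (f := f))
  have h2 := (Finset.card_image_le (s := Finset.univ) (f := g))
  rw [Finset.card_univ, hcard] at h1 h2
  omega

theorem finrank_range_planeMap {u v : Fin m → F} (h : Function.Injective (planeMap u v)) :
    Module.finrank F (LinearMap.range (planeMap u v)) = 2 := by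
  rw [LinearMap.finrank_range_of_inj h]
  simp

end PlaneMap

/-- A random linear map catches a pair `u, v`, in that some translate of their plane consists
mostly of points with unexpectedly large or small fibres, with probability at least almost half
the density of the bad subspaces. -/
theorem card_caught_ge {F : Type*} [Field F] [Fintype F] {n m k : ℕ} (hk : 0 < k)
    (hkm : k + m = n + 2)
    [Fintype ((Fin n → F) →ₗ[F] (Fin m → F))] [DecidableEq (Fin n → F)] [DecidableEq (Fin m → F)]
    (S : Finset (Fin n → F)) {τ μ : ℝ} (hτ : 0 < τ) (hμ : 0 < μ)
    [Fintype (Submodule F (Fin n → F))] [DecidableEq (Submodule F (Fin n → F))]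
    (Bad : Finset (Submodule F (Fin n → F))) (hrank : ∀ A ∈ Bad, Module.finrank F A = k)
    [∀ A : Submodule F (Fin n → F), DecidablePred (· ∈ A)]
    (hbad : ∀ A ∈ Bad, ∃ a : Fin n → F, τ * (μ * (Fintype.card F : ℝ) ^ 2) <
      |((S.filter fun x => x - a ∈ A).card : ℝ) - μ * (Fintype.card F : ℝ) ^ 2|) {δ : ℝ}
    (hδ : δ * (Finset.univ.filter fun A : Submodule F (Fin n → F) =>
      Module.finrank F A = k).card ≤ Bad.card) (hδ0 : 0 ≤ δ)
    {u v : Fin m → F} (huv : Function.Injective (planeMap u v))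
    (Caught : ((Fin n → F) →ₗ[F] (Fin m → F)) → Prop) [DecidablePred Caught]
    (hCaught : ∀ φ, (∃ x : Fin m → F, ((Finset.univ.filter fun st : Fin 2 → F =>
      ¬ τ / 2 * μ ≤ |((S.filter fun y => φ y = x + planeMap u v st).card : ℝ) - μ|).card : ℝ) ≤
      2 * (4 * (1 + τ) / (τ ^ 2 * μ) * (Fintype.card F : ℝ) ^ 2)) → Caught φ) :
    δ / 2 * (1 - 1 / Fintype.card F) * Fintype.card ((Fin n → F) →ₗ[F] (Fin m → F)) ≤
      (Finset.univ.filter fun φ => Caught φ).card := by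
  classical
  set q := Fintype.card F with hq
  have hq1 : 1 < q := Fintype.one_lt_card
  have hqR : (1 : ℝ) < q := by exact_mod_cast hq1
  set L := planeMap u v
  let P := LinearMap.range L
  let Φ : Submodule F (Fin n → F) → Finset ((Fin n → F) →ₗ[F] (Fin m → F)) :=
    fun A => Finset.univ.filter fun φ => P.comap φ = A
  have hU : (Fintype.card (Fin 2 → F) : ℝ) = (q : ℝ) ^ 2 := by simp [hq]
  have hhalf : ∀ A ∈ Bad, ((Φ A).card : ℝ) ≤ 2 * ((Φ A).filter Caught).card := by
    intro A hA
    obtain ⟨a, ha⟩ := hbad A hA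
    have h1 := sum_card_balanced_fibers_le L huv A (Φ A)
      (fun φ => by simp [Φ, P]) S a hτ hμ (by rw [hU]; exact ha)
    rw [hU] at h1
    have h2 := Finset.card_le_two_mul_card_filter_of_sum_le (Φ A) _
      (fun _ _ => Nat.cast_nonneg _) (by positivity) h1
    refine h2.trans ?_
    have h3 : (Φ A).filter _ ⊆ (Φ A).filter Caught :=
      Finset.monotone_filter_right (Φ A) fun φ _ hφ => hCaught φ ⟨φ a, hφ⟩
    have h4 := Finset.card_le_card h3
    have h5 : ((Finset.card _ : ℕ) : ℝ) ≤ ((Φ A).filter Caught).card := Nat.cast_le.2 h4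
    linarith
  have hdisj : ∑ A ∈ Bad, ((Φ A).filter Caught).card ≤
      (Finset.univ.filter fun φ => Caught φ).card := by
    rw [← Finset.card_biUnion]
    · refine Finset.card_le_card fun φ hφ => ?_
      obtain ⟨A, -, hφA⟩ := Finset.mem_biUnion.1 hφ
      exact Finset.mem_filter.2 ⟨Finset.mem_univ _, (Finset.mem_filter.1 hφA).2⟩
    · intro A _ B _ hAB
      rw [Function.onFun, Finset.disjoint_left]
      intro φ hφA hφB
      have h1 := (Finset.mem_filter.1 (Finset.mem_filter.1 hφA).1).2
      have h2 := (Finset.mem_filter.1 (Finset.mem_filter.1 hφB).1).2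
      exact hAB (h1.symm.trans h2)
  set All := Finset.univ.filter fun A : Submodule F (Fin n → F) => Module.finrank F A = k
  have htotal : (∑ A ∈ All, ((Φ A).card : ℝ)) =
      (Finset.univ.filter fun φ : (Fin n → F) →ₗ[F] (Fin m → F) =>
        Module.finrank F (P.comap φ) = k).card := by
    rw [Finset.card_eq_sum_card_fiberwise (f := fun φ => P.comap φ) (t := All)
      (fun φ hφ => by simpa [All] using hφ)]
    push_cast
    refine Finset.sum_congr rfl fun A hA => ?_
    congr 2
    ext φ
    simp only [Φ, All, Finset.mem_filter, Finset.mem_univ, true_and] at hA ⊢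
    exact ⟨fun h => ⟨h ▸ hA, h⟩, fun h => h.2⟩
  have hlow : (1 - 1 / (q : ℝ)) * Fintype.card ((Fin n → F) →ₗ[F] (Fin m → F)) ≤
      ∑ A ∈ All, ((Φ A).card : ℝ) := by
    rw [htotal]
    have h1 := card_finrank_comap_ne_mul_le (V := Fin n → F) P (k := k) (by
      rw [finrank_range_planeMap huv]
      simpa using hkm)
    have h2 : q ≤ q ^ k * (q - 1) := by
      calc q = q ^ 1 * 1 := by ring
        _ ≤ q ^ k * (q - 1) := Nat.mul_le_mul (Nat.pow_le_pow_right (by omega) hk) (by omega)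
    have h3 := (Nat.mul_le_mul_left _ h2).trans h1
    have h4 : ((Finset.univ.filter fun φ : (Fin n → F) →ₗ[F] (Fin m → F) =>
        Module.finrank F (P.comap φ) ≠ k).card : ℝ) ≤
        1 / q * Fintype.card ((Fin n → F) →ₗ[F] (Fin m → F)) := by
      rw [one_div, ← div_eq_inv_mul, le_div_iff₀ (by linarith)]
      exact_mod_cast h3
    have h5 : ((Finset.univ.filter fun φ : (Fin n → F) →ₗ[F] (Fin m → F) =>
        Module.finrank F (P.comap φ) = k).card : ℝ) +
        (Finset.univ.filter fun φ : (Fin n → F) →ₗ[F] (Fin m → F) =>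
        Module.finrank F (P.comap φ) ≠ k).card =
        Fintype.card ((Fin n → F) →ₗ[F] (Fin m → F)) := by
      exact_mod_cast Finset.card_filter_add_card_filter_not (s := Finset.univ) _
    linarith
  -- All classes `Φ A` with A of dimension k have the same size, so density among subspaces becomes
  -- probability among maps.
  have hequi : δ * ∑ A ∈ All, ((Φ A).card : ℝ) ≤ ∑ A ∈ Bad, ((Φ A).card : ℝ) := by
    rcases All.eq_empty_or_nonempty with h0 | ⟨A₀, hA₀⟩
    · rw [h0]
      simpa using Finset.sum_nonneg fun A _ => Nat.cast_nonneg _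
    · have h1 : ∀ A : Submodule F (Fin n → F), Module.finrank F A = k →
          ((Φ A).card : ℝ) = (Φ A₀).card := fun A hA => by
        have := card_filter_comap_eq_of_finrank_eq (W := Fin m → F) P
          (hA.trans (Finset.mem_filter.1 hA₀).2.symm)
        exact_mod_cast this
      rw [Finset.sum_congr rfl fun A hA => h1 A (Finset.mem_filter.1 hA).2,
        Finset.sum_congr rfl fun A hA => h1 A (hrank A hA), Finset.sum_const, Finset.sum_const,
        nsmul_eq_mul, nsmul_eq_mul, ← mul_assoc]
      exact mul_le_mul_of_nonneg_right hδ (Nat.cast_nonneg _)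
  have h6 : ∑ A ∈ Bad, ((Φ A).card : ℝ) ≤ 2 * (Finset.univ.filter fun φ => Caught φ).card := by
    refine (Finset.sum_le_sum hhalf).trans ?_
    rw [← Finset.mul_sum]
    have : (∑ A ∈ Bad, (((Φ A).filter Caught).card : ℝ)) ≤
      (Finset.univ.filter fun φ => Caught φ).card := by exact_mod_cast hdisj
    linarith
  have h7 := mul_le_mul_of_nonneg_left hlow hδ0
  linarith

/-! ### Numerical constants and the main count -/

/-- With p = 15δ/32 and Np ≥ 15/8, (1 - p)^N ≤ (1 + p)^(-N) ≤ 1/(1 + Np) ≤ 8/23. -/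
theorem one_sub_mul_pow_ceil_le {δ : ℝ} (hδ₀ : 0 < δ) (hδ₁ : δ < 1) :
    (1 - 15 / 32 * δ) ^ ⌈4 / δ⌉₊ ≤ 8 / 23 := by
  set N := ⌈4 / δ⌉₊
  have hN1 : 4 / δ ≤ N := Nat.le_ceil _
  obtain ⟨p, hp⟩ : ∃ p, p = 15 / 32 * δ := ⟨_, rfl⟩
  rw [← hp]
  have hp0 : 0 < p := by rw [hp]; positivity
  have hp1 : p < 1 := by linarith
  have h1 : 1 + (N : ℝ) * p ≤ (1 + p) ^ N := one_add_mul_le_pow (by linarith) N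
  have h2 : (1 - p) ^ N * (1 + p) ^ N ≤ 1 := by
    rw [← mul_pow]
    exact pow_le_one₀ (by nlinarith) (by nlinarith)
  have h3 : 15 / 8 ≤ (N : ℝ) * p := by
    have h4 : 4 / δ * p = 15 / 8 := by rw [hp]; field_simp; norm_num
    rw [← h4]
    exact mul_le_mul_of_nonneg_right hN1 hp0.le
  have h5 : 0 ≤ (1 - p) ^ N := pow_nonneg (by linarith) _
  have h6 : (1 - p) ^ N * (23 / 8) ≤ (1 - p) ^ N * (1 + p) ^ N :=
    mul_le_mul_of_nonneg_left (by linarith) h5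
  linarith

theorem ceil_mul_le_of_mul_le_sq {δ ε : ℝ} (hδ₀ : 0 < δ) (hδ₁ : δ < 1) (hε : 0 < ε)
    (h : 40 * ε ≤ δ ^ 2) : ⌈4 / δ⌉₊ * ε ≤ 1 / 8 := by
  have h1 := (Nat.ceil_lt_add_one (show 0 ≤ 4 / δ by positivity)).le
  have h2 : 1 ≤ 1 / δ := by rw [le_div_iff₀ hδ₀]; linarith
  have hN2 : (⌈4 / δ⌉₊ : ℝ) ≤ 5 / δ := by
    calc (⌈4 / δ⌉₊ : ℝ) ≤ 4 / δ + 1 := h1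
      _ ≤ 4 / δ + 1 / δ := by linarith
      _ = 5 / δ := by ring
  have h3 : 5 / δ * ε ≤ 1 / 8 := by
    rw [div_mul_eq_mul_div, div_le_iff₀ hδ₀]
    nlinarith
  exact (mul_le_mul_of_nonneg_right hN2 hε.le).trans h3

theorem eight_mul_mul_chebyshev_le {n τ δ μ : ℝ} (hτ : 0 < τ) (hδ : 0 < δ) (hμ : 0 < μ)
    (h : 32 * (n * (1 + τ) / (τ * δ) ^ 2) ≤ μ) :
    8 * n * (4 * (1 + τ) / (τ ^ 2 * μ)) ≤ δ ^ 2 := by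
  rw [mul_div_assoc', div_le_iff₀ (by positivity)] at h ⊢
  linarith

theorem mul_two_mul_add_three_div_lt {m n q ε δ : ℝ} (hmn : m ≤ n) (hq : 0 < q)
    (hqn : 32 * n ≤ q) (hε : 0 < ε) (hδ₀ : 0 < δ) (hδ₁ : δ < 1) (h : 8 * n * ε ≤ δ ^ 2) :
    m * (2 * ε + 3 / q) < 1 / 2 := by
  have h1 : m * (3 / q) ≤ 3 / 32 := by
    rw [mul_div_assoc', div_le_iff₀ hq]
    linarith
  have h2 : m * ε ≤ n * ε := mul_le_mul_of_nonneg_right hmn hε.le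
  have h3 : δ ^ 2 < 1 := pow_lt_one₀ hδ₀.le hδ₁ two_ne_zero
  linarith

/-- A random linear map has few fibres of unexpected size. -/
theorem sum_card_deviating_fibers_linearMap_le {F V W : Type*} [Field F] [AddCommGroup V]
    [Module F V] [AddCommGroup W] [Module F W] [Fintype W] [DecidableEq W]
    [Fintype (V →ₗ[F] W)] (S : Finset V) {τ μ : ℝ} (hτ : 0 < τ) (hμ : 0 < μ)
    (hS : (S.card : ℝ) / Fintype.card W = μ) :
    ∑ φ : V →ₗ[F] W, ((Finset.univ.filter fun y =>
      τ / 2 * μ ≤ |((S.filter fun x => φ x = y).card : ℝ) - μ|).card : ℝ) ≤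
      Fintype.card (V →ₗ[F] W) * (4 * (1 + τ) / (τ ^ 2 * μ)) * Fintype.card W := by
  classical
  have hW : (0 : ℝ) < Fintype.card W := by exact_mod_cast Fintype.card_pos
  have h1 := sum_card_deviating_fibers_le (Finset.univ : Finset (V →ₗ[F] W))
    (fun φ x => φ x) S Fintype.card_pos (fun x _ x' _ hne => by
      have h2 := card_mul_card_filter_apply_eq_le (LinearMap.id (R := F) (M := W))
        Function.injective_id (Finset.univ : Finset (V →ₗ[F] W))
        (fun _ _ _ => Finset.mem_univ _) (sub_ne_zero.2 hne) 0
      simpa only [map_sub, sub_eq_zero] using h2) (c := τ / 2 * μ) (by positivity)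
  rw [div_eq_iff hW.ne'] at hS
  rw [hS, mul_div_cancel_right₀ _ hW.ne', Finset.card_univ] at h1
  have h4 : 0 < (τ / 2 * μ) ^ 2 := by positivity
  refine le_of_mul_le_mul_right (h1.trans ?_) h4
  have h5 : Fintype.card (V →ₗ[F] W) * (4 * (1 + τ) / (τ ^ 2 * μ)) * Fintype.card W *
      (τ / 2 * μ) ^ 2 = Fintype.card (V →ₗ[F] W) * (μ * Fintype.card W) * (1 + τ) := by
    field_simp
    ring
  rw [h5]
  exact le_mul_of_one_le_right (by positivity) (by linarith)

/-- The main counting statement: subspaces with a badly balanced translate are rare. -/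
theorem card_bad_subspaces_le {F : Type*} [Field F] [Fintype F] {n m k : ℕ} (hm : 3 ≤ m)
    (hmn : m ≤ n) (hkm : k + m = n + 2) (S : Finset (Fin n → F))
    (hS : Fintype.card F ^ (m + 1) < S.card) {τ δ : ℝ} (hτ : 0 < τ) (hδ₀ : 0 < δ) (hδ₁ : δ < 1)
    (hq : 32 * ((n : ℝ) * (1 + τ) / (τ * δ) ^ 2) ≤ Fintype.card F)
    (hqn : 32 * (n : ℝ) ≤ Fintype.card F) (hn : 5 ≤ n)
    [Fintype (Submodule F (Fin n → F))]
    [∀ A : Submodule F (Fin n → F), DecidablePred (· ∈ A)]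
    (Bad : Finset (Submodule F (Fin n → F))) (hrank : ∀ A ∈ Bad, Module.finrank F A = k)
    (hbad : ∀ A ∈ Bad, ∃ a : Fin n → F,
      τ * (S.card / (Fintype.card F : ℝ) ^ m * (Fintype.card F : ℝ) ^ 2) <
      |((S.filter fun x => x - a ∈ A).card : ℝ) -
        S.card / (Fintype.card F : ℝ) ^ m * (Fintype.card F : ℝ) ^ 2|) :
    (Bad.card : ℝ) ≤ δ * (Finset.univ.filter fun A : Submodule F (Fin n → F) =>
      Module.finrank F A = k).card := by
  classical
  by_contra! hcontra
  have : Finite ((Fin n → F) →ₗ[F] (Fin m → F)) :=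
    DFunLike.finite _
  let _ : Fintype ((Fin n → F) →ₗ[F] (Fin m → F)) := Fintype.ofFinite _
  set q := Fintype.card F with hqdef
  set H := Fintype.card ((Fin n → F) →ₗ[F] (Fin m → F)) with hH
  have hnR : (5 : ℝ) ≤ n := by exact_mod_cast hn
  have hmnR : (m : ℝ) ≤ n := by exact_mod_cast hmn
  have hqR : (160 : ℝ) ≤ q := by linarith
  have hq0 : (0 : ℝ) < q := by linarith
  have hcardW : Fintype.card (Fin m → F) = q ^ m := by simp [hqdef]
  have hqm : (0 : ℝ) < (q : ℝ) ^ m := pow_pos hq0 _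
  have hq2m : (0 : ℝ) < (q : ℝ) ^ (2 * m) := pow_pos hq0 _
  have hW : (Fintype.card (Fin m → F) : ℝ) = (q : ℝ) ^ m := by rw [hcardW]; push_cast; rfl
  obtain ⟨μ, hμdef⟩ : ∃ μ : ℝ, (S.card : ℝ) / (q : ℝ) ^ m = μ := ⟨_, rfl⟩
  rw [hμdef] at hbad
  have hμq : (q : ℝ) < μ := by
    rw [← hμdef, lt_div_iff₀ (by positivity), ← pow_succ']
    exact_mod_cast hS
  have hμ : 0 < μ := hq0.trans hμq
  have hεδ := eight_mul_mul_chebyshev_le hτ hδ₀ hμ (hq.trans hμq.le)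
  have hcheb := sum_card_deviating_fibers_linearMap_le (F := F) (W := Fin m → F) S hτ hμ
    (by rw [hW]; exact hμdef)
  have hcaughtge := fun u v huv => card_caught_ge (k := k) (u := u) (v := v) (by omega) hkm S hτ hμ
    Bad hrank hbad hcontra.le hδ₀.le huv
  have hε0 : 0 < 4 * (1 + τ) / (τ ^ 2 * μ) := by positivity
  obtain ⟨ε, hε⟩ : ∃ ε : ℝ, 4 * (1 + τ) / (τ ^ 2 * μ) = ε := ⟨_, rfl⟩
  simp only [hε] at hcaughtge
  rw [hε] at hεδ hcheb hε0
  -- This is 8nε ≤ δ² with n ≥ 5.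
  have h40 : 40 * ε ≤ δ ^ 2 := by nlinarith
  clear hbad hcontra
  let T : ((Fin n → F) →ₗ[F] (Fin m → F)) → Finset (Fin m → F) := fun φ =>
    Finset.univ.filter fun y => τ / 2 * μ ≤ |((S.filter fun x => φ x = y).card : ℝ) - μ|
  let Caught : (Fin m → F) × (Fin m → F) → ((Fin n → F) →ₗ[F] (Fin m → F)) → Prop := fun p φ =>
    ∃ x : Fin m → F, ((Finset.univ.filter fun st : Fin 2 → F =>
      ¬ τ / 2 * μ ≤ |((S.filter fun y => φ y = x + planeMap p.1 p.2 st).card : ℝ) - μ|).card : ℝ) ≤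
      2 * (ε * (q : ℝ) ^ 2)
  let cost : ((Fin n → F) →ₗ[F] (Fin m → F)) → ℝ := fun φ => (T φ).card / (q : ℝ) ^ m
  have hcost : ∑ φ, cost φ ≤ H * ε := by
    simp only [cost]
    rw [← Finset.sum_div, div_le_iff₀ (by positivity), ← hW]
    exact hcheb
  set G : Finset ((Fin m → F) × (Fin m → F)) :=
    Finset.univ.filter fun p => Function.Injective (planeMap p.1 p.2) with hG
  have hcaught : ∀ p ∈ G, 15 / 32 * δ * H ≤ (Finset.univ.filter fun φ => Caught p φ).card := by
    intro p hp
    refine le_trans ?_ (hcaughtge p.1 p.2 (Finset.mem_filter.1 hp).2 (Caught p) fun φ hφ => hφ)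
    have h1 : 1 / (q : ℝ) ≤ 1 / 160 := one_div_le_one_div_of_le (by norm_num) hqR
    refine mul_le_mul_of_nonneg_right ?_ (Nat.cast_nonneg _)
    rw [← hqdef]
    nlinarith
  set N := ⌈4 / δ⌉₊ with hN
  have : Nonempty ((Fin n → F) →ₗ[F] (Fin m → F)) := ⟨0⟩
  -- This weight turns the number of missed pairs into a density, comparable with the density of T'.
  have hκ : (0 : ℝ) < 1 / (q : ℝ) ^ (2 * m) := by positivity
  obtain ⟨f, hf⟩ := exists_covering_choice Caught cost (p := 15 / 32 * δ) (by linarith) hκ.le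
    hcost N G hcaught
  have hGcard : (G.card : ℝ) ≤ (q : ℝ) ^ (2 * m) := by
    have h1 : G.card ≤ Fintype.card ((Fin m → F) × (Fin m → F)) := Finset.card_le_univ _
    rw [Fintype.card_prod, hcardW, ← pow_add, ← two_mul] at h1
    exact_mod_cast h1
  have hpow := one_sub_mul_pow_ceil_le hδ₀ hδ₁
  have hNε := ceil_mul_le_of_mul_le_sq hδ₀ hδ₁ hε0 h40
  rw [← hN] at hpow hNε
  set T' : Finset (Fin m → F) := Finset.univ.biUnion fun s => T (f s) with hT'
  set D := G.filter fun p => ∃ s, Caught p (f s) with hD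
  set missed := G.filter fun p => ∀ s, ¬ Caught p (f s) with hmissed
  have hT'cost : (T'.card : ℝ) / (q : ℝ) ^ m ≤ ∑ s, cost (f s) := by
    simp only [cost]
    rw [← Finset.sum_div]
    refine div_le_div_of_nonneg_right ?_ hqm.le
    exact_mod_cast Finset.card_biUnion_le
  have hDG : D.card + missed.card = G.card := by
    have h1 := Finset.card_filter_add_card_filter_not (s := G) fun p => ∃ s, Caught p (f s)
    simpa only [not_exists] using h1
  have hGcompl : (q : ℝ) ^ (2 * m) - 2 * (q : ℝ) ^ (m + 1) ≤ G.card := by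
    have h1 := Finset.card_filter_add_card_filter_not
      (s := (Finset.univ : Finset ((Fin m → F) × (Fin m → F))))
      fun p => Function.Injective (planeMap p.1 p.2)
    have h2 := card_not_injective_planeMap_le (F := F) (m := m)
    rw [Finset.card_univ, Fintype.card_prod, hcardW, ← pow_add, ← two_mul] at h1
    have h3 : q ^ (2 * m) ≤ G.card + 2 * q ^ (m + 1) := by
      rw [← h1]
      exact Nat.add_le_add_left h2 _
    have h4 : (q : ℝ) ^ (2 * m) ≤ G.card + 2 * (q : ℝ) ^ (m + 1) := by exact_mod_cast h3
    linarith
  have hsmallpow : 2 * (q : ℝ) ^ (m + 1) ≤ 1 / 80 * (q : ℝ) ^ (2 * m) := by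
    have h1 : (q : ℝ) ^ (m + 1 + 1) ≤ (q : ℝ) ^ (2 * m) :=
      pow_le_pow_right₀ (by linarith) (by omega)
    rw [pow_succ _ (m + 1)] at h1
    have h2 : 0 < (q : ℝ) ^ (m + 1) := pow_pos hq0 _
    nlinarith
  have hκq : 1 / (q : ℝ) ^ (2 * m) * (q : ℝ) ^ (2 * m) = 1 := one_div_mul_cancel hq2m.ne'
  -- The sum 1/8 + 8/23 = 87/184 is below 1/2, with room for the 1/80 lost to dependent pairs. So T'
  -- has density at most 1/2 and at least half of all pairs are caught.
  have hfinal : (T'.card : ℝ) / (q : ℝ) ^ m + 1 / (q : ℝ) ^ (2 * m) * missed.card ≤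
      1 / 8 + 8 / 23 := by
    have h1 : 1 / (q : ℝ) ^ (2 * m) * (G.card * (1 - 15 / 32 * δ) ^ N) ≤ 8 / 23 := by
      have h2 : 1 / (q : ℝ) ^ (2 * m) * G.card ≤ 1 := by
        exact (mul_le_mul_of_nonneg_left hGcard hκ.le).trans hκq.le
      rw [← mul_assoc]
      have h3 : 0 ≤ (1 - 15 / 32 * δ) ^ N := pow_nonneg (by linarith) _
      exact (mul_le_of_le_one_left h3 h2).trans hpow
    linarith
  have hmissed0 : 0 ≤ 1 / (q : ℝ) ^ (2 * m) * missed.card := mul_nonneg hκ.le (Nat.cast_nonneg _)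
  have hT'0 : 0 ≤ (T'.card : ℝ) / (q : ℝ) ^ m := div_nonneg (Nat.cast_nonneg _) hqm.le
  have hT'small : 2 * T'.card ≤ q ^ m := by
    have h1 : (T'.card : ℝ) / (q : ℝ) ^ m ≤ 1 / 2 := by linarith
    rw [div_le_iff₀ hqm] at h1
    have h2 : 2 * (T'.card : ℝ) ≤ (q : ℝ) ^ m := by linarith
    exact_mod_cast h2
  have hDlarge : q ^ (2 * m) ≤ 2 * D.card := by
    have h1 : 1 / (q : ℝ) ^ (2 * m) * missed.card ≤ 1 / 8 + 8 / 23 := by linarith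
    rw [one_div_mul_eq_div, div_le_iff₀ hq2m] at h1
    have h2 : (D.card : ℝ) + missed.card = G.card := by exact_mod_cast hDG
    have h4 : (q : ℝ) ^ (2 * m) ≤ 2 * D.card := by linarith
    exact_mod_cast h4
  refine absurd (card_lt_two_mul_card_of_planes T' D hε0.le (by omega) ?_ ?_ hDlarge)
    (not_lt.2 hT'small)
  · rw [← hqdef]
    exact mul_two_mul_add_three_div_lt hmnR hq0 hqn hε0 hδ₀ hδ₁ hεδ
  · intro p hp
    obtain ⟨s, x, hx⟩ := (Finset.mem_filter.1 hp).2
    refine ⟨x, ?_⟩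
    have h1 := Finset.card_filter_add_card_filter_not (s := (Finset.univ : Finset (Fin 2 → F)))
      fun st => τ / 2 * μ ≤ |((S.filter fun y => f s y = x + planeMap p.1 p.2 st).card : ℝ) - μ|
    have h2 : (Finset.univ.filter fun st : Fin 2 → F => τ / 2 * μ ≤
        |((S.filter fun y => f s y = x + planeMap p.1 p.2 st).card : ℝ) - μ|).card ≤
        (Finset.univ.filter fun st : Fin 2 → F => x + st 0 • p.1 + st 1 • p.2 ∈ T').card := by
      refine Finset.card_le_card fun st hst => ?_
      rw [Finset.mem_filter] at hst ⊢
      refine ⟨hst.1, Finset.mem_biUnion.2 ⟨s, Finset.mem_univ _, ?_⟩⟩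
      rw [add_assoc, ← planeMap_apply]
      exact Finset.mem_filter.2 ⟨Finset.mem_univ _, hst.2⟩
    have h3 : (Finset.univ : Finset (Fin 2 → F)).card = q ^ 2 := by simp [hqdef]
    rw [h3] at h1
    have h1R := congrArg (Nat.cast (R := ℝ)) h1
    push_cast at h1R
    have h2R := Nat.cast_le (α := ℝ).2 h2
    linarith only [h1R, h2R, hx]

theorem mainTheorem2 (F : Type*) [Field F] [Finite F] (n : ℕ) (hn : 5 ≤ n)
    (S : Set (Fin n → F)) (hS : Nat.card F ^ 4 < S.ncard)
    (τ δ : ℝ) (hτ : 0 < τ) (hδ₀ : 0 < δ) (hδ₁ : δ < 1)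
    (hq : 32 * max ((n : ℝ) * (1 + τ) / (τ * δ) ^ 2) (n : ℝ) ≤ (Nat.card F : ℝ))
    (r : ℕ) (hr₄ : 4 ≤ r) (hrn : r ≤ n - 1)
    (hSlower : Nat.card F ^ r < S.ncard) (hSupper : S.ncard ≤ Nat.card F ^ (r + 1))
    (k : ℕ) (hk : k = n - r + 3) :
    (1 - δ) * (Nat.card (linearSubspaces F n k) : ℝ) ≤
      (Nat.card {A : linearSubspaces F n k // IsShiftBalanced τ S A} : ℝ) := by
  classical
  let _ : Fintype F := Fintype.ofFinite F
  let _ : Fintype (Submodule F (Fin n → F)) := Fintype.ofFinite _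
  -- With m = r - 1 one has n - k = m - 2, so the expected size of a k-flat's intersection with S is
  -- μq²: q² fibres of size μ.
  have hexp : (expectedCard k S : ℝ) =
      S.toFinset.card / (Fintype.card F : ℝ) ^ (r - 1) * (Fintype.card F : ℝ) ^ 2 := by
    have h0 : (0 : ℝ) < Fintype.card F := by exact_mod_cast Fintype.card_pos
    rw [expectedCard, Nat.card_eq_fintype_card, Set.ncard_eq_toFinset_card',
      show r - 1 = n - k + 2 by omega, pow_add]
    field_simp
  have hcount : ∀ (A : linearSubspaces F n k) (a : Fin n → F),
      (((shift A a).1 : Set (Fin n → F)) ∩ S).ncard =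
        (S.toFinset.filter fun x => x - a ∈ A.1).card := by
    intro A a
    rw [← Set.ncard_coe_finset]
    congr 1
    ext x
    simp [shift, AffineSubspace.mem_mk', and_comm]
  set All := Finset.univ.filter fun A : Submodule F (Fin n → F) => Module.finrank F A = k
  set BadSub := (Finset.univ : Finset (linearSubspaces F n k)).filter
    fun A => ¬ IsShiftBalanced τ S A
  have hbad := card_bad_subspaces_le (m := r - 1) (k := k) (by omega) (by omega) (by omega)
    S.toFinset (by
      rw [← Set.ncard_eq_toFinset_card', ← Nat.card_eq_fintype_card, Nat.sub_add_cancel (by omega)]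
      exact hSlower) hτ hδ₀ hδ₁
    (by
      rw [← Nat.card_eq_fintype_card]
      exact (mul_le_mul_of_nonneg_left (le_max_left _ _) (by norm_num)).trans hq)
    (by
      rw [← Nat.card_eq_fintype_card]
      exact (mul_le_mul_of_nonneg_left (le_max_right _ _) (by norm_num)).trans hq)
    hn (BadSub.map (Function.Embedding.subtype _)) (fun A hA => by
      obtain ⟨A, -, rfl⟩ := Finset.mem_map.1 hA
      exact A.2) (fun A hA => by
      obtain ⟨A, hA', rfl⟩ := Finset.mem_map.1 hA
      have hns := (Finset.mem_filter.1 hA').2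
      unfold IsShiftBalanced at hns
      push Not at hns
      obtain ⟨a, ha⟩ := hns
      refine ⟨a, ?_⟩
      rw [IsBalanced, not_le, hcount, hexp] at ha
      exact ha)
  have hall : Nat.card (linearSubspaces F n k) = All.card :=
    Nat.subtype_card All fun A => by simp [All, linearSubspaces]
  have hgood : Nat.card {A : linearSubspaces F n k // IsShiftBalanced τ S A} + BadSub.card =
      All.card := by
    rw [← hall, Nat.card_eq_fintype_card, Nat.card_eq_fintype_card, Fintype.card_subtype]
    exact Finset.card_filter_add_card_filter_not _
  have hgoodR : (Nat.card {A : linearSubspaces F n k // IsShiftBalanced τ S A} : ℝ) +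
      BadSub.card = All.card := by exact_mod_cast hgood
  rw [Finset.card_map] at hbad
  rw [hall]
  linarith
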